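/- Let $n\ge 0$ be an integer, $\lambda>0$, $\mathbb R_+^{n+1}:=\mathbb R^n\times(0,\infty)$, and let $dm_\lambda(x):=x_{n+1}^{2\lambda}\,dx$ on $\mathbb R_+^{n+1}$. For $x\in\mathbb R_+^{n+1}$ and $r>0$ put $B_+(x,r):=\{y\in\mathbb R_+^{n+1}:|x-y|<r\}$. A *system of dyadic cubes* with parameter $\delta\in(0,1)$ is a family $\mathcal D=\bigcup_{k\in\mathbb Z}\mathcal D_k$, $\mathcal D_k=\{Q^k_\alpha:\alpha\in\mathcal A_k\}$ with $\mathcal A_k$ countable, of Borel subsets $Q_\alpha^k$ of $\mathbb R_+^{n+1}$ with center points $x_\alpha^k\in Q_\alpha^k$ such that: (I) for each $k$, $\mathbb R_+^{n+1}$ is the disjoint union of the $Q_\alpha^k$, $\alpha\in\mathcal A_k$; (II) if $l\ge k$, then $Q^l_\beta\subseteq Q^k_\alpha$ or $Q^l_\beta\cap Q^k_\alpha=\emptyset$; (III) for each $(k,\alpha)$ and $l\le k$ there is a unique $\beta\in\mathcal A_l$ with $Q^k_\alpha\subseteq Q^l_\beta$; (IV) each $Q_\alpha^k$ is the union of the cubes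 of $\mathcal D_{k+1}$ contained in it, whose number is bounded by a constant $M$ independent of $(k,\alpha)$; (V) $B_+(x^k_\alpha,\tfrac1{12}\delta^k)\subseteq Q_\alpha^k\subseteq B_+(x^k_\alpha,4\delta^k)$; (VI) if $l\ge k$ and $Q^l_\beta\subseteq Q^k_\alpha$, then $B_+(x^l_\beta,4\delta^l)\subseteq B_+(x^k_\alpha,4\delta^k)$. A finite collection $\{\mathcal D^\nu\}_{\nu=1}^\kappa$ of systems of dyadic cubes with the same parameter $\delta$ is a *collection of adjacent systems* with parameters $\delta$ and $C_{\rm adj}\in[1,\infty)$ if for all $x\in\mathbb R_+^{n+1}$, $k\in\mathbb Z$ and $\delta^{k+3}<r\le\delta^{k+2}$ there are $\nu$ and $Q\in\mathcal D^\nu_k$, with center point $c$, such that $|x-c|<2\delta^k$ and $B_+(x,r)\subseteq Q\subseteq B_+(x,C_{\rm adj}r)$. Fix a collection $\{\mathcal D^\nu\}_{\nu=1}^\kappa$ of adjacent systems of dyadic cubes. Write $\langle f\rangle_Q:=m_\lambda(Q)^{-1}\int_Q f\,dm_\lambda$ and $$MO_Q(f):=\frac1{m_\lambda(Q)}\int_Q|f-\langle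 f\rangle_Q|\,dm_\lambda$$ (with $MO_Q(f):=\infty$ if $f$ is not integrable on $Q$). For $0<p,q<\infty$ and a family $a$ of elements of $[0,\infty]$ with non-increasing rearrangement $(a_k^*)_{k\ge1}$ put $\|a\|_{\ell^{p,q}}:=\big(\sum_{k\ge1}(a_k^*)^q\,k^{q/p-1}\big)^{1/q}$. Put $$\|f\|_{\mathrm{OSC}_{p,q}}:=\sum_{\nu=1}^\kappa\big\|\{MO_Q(f)\}_{Q\in\mathcal D^\nu}\big\|_{\ell^{p,q}},\qquad \|f\|_{B_p}:=\left(\int_{\mathbb R_+^{n+1}}\int_{\mathbb R_+^{n+1}}\frac{|f(x)-f(y)|^p}{m_\lambda(B_+(x,|x-y|))^2}\,dm_\lambda(y)\,dm_\lambda(x)\right)^{1/p}.$$ **Proposition.** Let $n+1<p<\infty$ and let $f\in L^p_{\rm loc}(\mathbb R_+^{n+1},dm_\lambda)$ be complex valued (that is, $f\in L^p(K,dm_\lambda)$ for every compact $K\subset\mathbb R_+^{n+1}$). Then $\|f\|_{\mathrm{OSC}_{p,p}}<\infty$ if and only if $\|f\|_{B_p}<\infty$, that is, $f\in\mathrm{OSC}_{p,p}(\mathbb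 R_+^{n+1},dm_\lambda)$ if and only if $f\in B_p(\mathbb R_+^{n+1},dm_\lambda)$. Moreover there is a constant $C>0$, depending only on $n,\lambda,p,\delta$ and $\kappa$, such that $$\|f\|_{\mathrm{OSC}_{p,p}}\le C\,\|f\|_{B_p}\qquad\text{and}\qquad \|f\|_{B_p}\le C\,\|f\|_{\mathrm{OSC}_{p,p}}.$$ -/

import Mathlib

open MeasureTheory Set
open scoped ENNReal NNReal

noncomputable section

namespace Bessel

/-- The ambient Euclidean space `ℝ^{n+1}`. -/
abbrev Space (n : ℕ) : Type := EuclideanSpace ℝ (Fin (n + 1))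

/-- The open upper half space `ℝ^{n+1}_+ = ℝ^n × (0, ∞)`. -/
def halfSpace (n : ℕ) : Set (Space n) := {x | 0 < x (Fin.last n)}

/-- The Bessel measure `dm_lam = x_{n+1}^{2 lam} dx` on the half space, regarded as a measure on
`ℝ^{n+1}` that gives no mass to the complement of the half space. -/
def besselMeasure (n : ℕ) (lam : ℝ) : Measure (Space n) :=
  (volume.restrict (halfSpace n)).withDensity
    (fun x => ENNReal.ofReal (x (Fin.last n) ^ (2 * lam)))

/-- The Bessel ball: Euclidean ball intersected with the half space. -/
def besselBall {n : ℕ} (x : Space n) (r : ℝ) : Set (Space n) := Metric.ball x r ∩ halfSpace n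

/-- `f ∈ L^p_loc(ℝ^{n+1}_+, dm_lam)`: `f` is `p`-integrable on each compact subset of the open half
space. Values of `f` off the half space play no role. -/
def LpLoc {n : ℕ} (lam p : ℝ) (f : Space n → ℂ) : Prop :=
  ∀ K : Set (Space n), IsCompact K → K ⊆ halfSpace n →
    MemLp f (ENNReal.ofReal p) ((besselMeasure n lam).restrict K)

/-- A system of dyadic cubes with parameter `δ` over the half space: for each generation `k : ℤ` a
countable family of Borel sets `cube k α` with center points `center k α`. -/
structure DyadicSystem (n : ℕ) (δ : ℝ) where
  /-- index set of the cubes of generation `k` -/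
  A : ℤ → Type
  countable_index : ∀ k, Countable (A k)
  cube : ∀ k, A k → Set (Space n)
  center : ∀ k, A k → Space n
  measurableSet_cube : ∀ k α, MeasurableSet (cube k α)
  center_mem : ∀ k α, center k α ∈ cube k α
  /-- each generation partitions the half space -/
  iUnion_cube : ∀ k, ⋃ α, cube k α = halfSpace n
  disjoint_cube : ∀ k (α β : A k), α ≠ β → Disjoint (cube k α) (cube k β)
  nested : ∀ (k l : ℤ) (α : A k) (β : A l), k ≤ l →
    cube l β ⊆ cube k α ∨ Disjoint (cube k α) (cube l β)
  exists_unique_ancestor : ∀ (k l : ℤ) (α : A k), l ≤ k → ∃! β : A l, cube k α ⊆ cube l β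
  /-- uniformly bounded number of children -/
  bounded_children : ∃ M : ℕ, ∀ (k : ℤ) (α : A k),
    {β : A (k + 1) | cube (k + 1) β ⊆ cube k α}.encard ≤ M
  eq_union_children : ∀ (k : ℤ) (α : A k),
    cube k α = ⋃ β ∈ {β : A (k + 1) | cube (k + 1) β ⊆ cube k α}, cube (k + 1) β
  ball_subset : ∀ (k : ℤ) (α : A k), besselBall (center k α) (1 / 12 * δ ^ k) ⊆ cube k α
  subset_ball : ∀ (k : ℤ) (α : A k), cube k α ⊆ besselBall (center k α) (4 * δ ^ k)
  ball_subset_ball : ∀ (k l : ℤ) (α : A k) (β : A l), k ≤ l → cube l β ⊆ cube k α →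
    besselBall (center l β) (4 * δ ^ l) ⊆ besselBall (center k α) (4 * δ ^ k)

/-- A collection of `κ` adjacent systems of dyadic cubes over the half space with parameters `δ` and
`Cadj`: every Bessel ball is contained in a cube of comparable size from one of the systems. -/
structure AdjacentSystems (n κ : ℕ) (δ Cadj : ℝ) where
  sys : Fin κ → DyadicSystem n δ
  adjacent : ∀ x ∈ halfSpace n, ∀ (r : ℝ) (k : ℤ), δ ^ (k + 3) < r → r ≤ δ ^ (k + 2) →
    ∃ (ν : Fin κ) (α : (sys ν).A k), dist x ((sys ν).center k α) < 2 * δ ^ k ∧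
      besselBall x r ⊆ (sys ν).cube k α ∧ (sys ν).cube k α ⊆ besselBall x (Cadj * r)

/-- The mean oscillation `MO_E(f) = ⨍_E |f - (f)_E| dm_lam`, with values in `[0, ∞]`. If `E` has
positive finite measure and `f` is measurable but not integrable on `E`, its value is `∞`. -/
def meanOsc {n : ℕ} (lam : ℝ) (f : Space n → ℂ) (E : Set (Space n)) : ℝ≥0∞ :=
  ⨍⁻ x in E, ‖f x - ⨍ z in E, f z ∂(besselMeasure n lam)‖ₑ ∂(besselMeasure n lam)

/-- The non-increasing rearrangement of a family `a` of elements of `[0, ∞]`, indexed from `0`. -/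
def rearrangement {ι : Type*} (a : ι → ℝ≥0∞) (k : ℕ) : ℝ≥0∞ :=
  sInf {t : ℝ≥0∞ | {i | t < a i}.encard ≤ k}

open Classical in
/-- The Lebesgue-Lorentz sequence norm
`‖a‖_{ℓ^{p,q}} = (∑_{k ≥ 1} (a_k^*)^q k^{q/p-1})^{1/q}`, resp. `sup_{k ≥ 1} k^{1/p} a_k^*` if
`q = ∞` (the rearrangement below is indexed from `0`). -/
def lorentzNorm {ι : Type*} (p : ℝ) (q : ℝ≥0∞) (a : ι → ℝ≥0∞) : ℝ≥0∞ :=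
  if q = ∞ then ⨆ k : ℕ, ((k : ℝ≥0∞) + 1) ^ (1 / p) * rearrangement a k
  else (∑' k : ℕ, rearrangement a k ^ q.toReal * ((k : ℝ≥0∞) + 1) ^ (q.toReal / p - 1)) ^
    (1 / q.toReal)

/-- The oscillation norm `‖f‖_{OSC_{p,q}} = ∑_ν ‖{MO_Q(f)}_{Q ∈ D^ν}‖_{ℓ^{p,q}}`. -/
def oscNorm {n κ : ℕ} {δ Cadj : ℝ} (D : AdjacentSystems n κ δ Cadj) (lam p : ℝ) (q : ℝ≥0∞)
    (f : Space n → ℂ) : ℝ≥0∞ :=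
  ∑ ν : Fin κ, lorentzNorm p q
    (fun Q : (Σ k : ℤ, (D.sys ν).A k) => meanOsc lam f ((D.sys ν).cube Q.1 Q.2))

/-- `f ∈ OSC_{p,q}(ℝ^{n+1}_+, dm_lam)`. -/
def MemOSC {n κ : ℕ} {δ Cadj : ℝ} (D : AdjacentSystems n κ δ Cadj) (lam p : ℝ) (q : ℝ≥0∞)
    (f : Space n → ℂ) : Prop :=
  oscNorm D lam p q f < ∞

/-- The weighted Besov norm
`(∫∫ |f x - f y|^p / m_lam(B(x, |x - y|))^2 dm_lam(y) dm_lam(x))^{1/p}`. -/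
def besovNorm {n : ℕ} (lam p : ℝ) (f : Space n → ℂ) : ℝ≥0∞ :=
  (∫⁻ x, ∫⁻ y, ‖f x - f y‖ₑ ^ p / besselMeasure n lam (besselBall x (dist x y)) ^ 2
    ∂(besselMeasure n lam) ∂(besselMeasure n lam)) ^ (1 / p)

/-- `f ∈ B_p(ℝ^{n+1}_+, dm_lam)`. -/
def MemBesov {n : ℕ} (lam p : ℝ) (f : Space n → ℂ) : Prop :=
  LpLoc lam p f ∧ besovNorm lam p f < ∞

end Bessel

end

/-! The Besov kernel m(B(x,|x-y|))⁻² is comparable to a sum of dyadic kernels K_ν(x,y) = ∑_Q 1_Q(x)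
1_Q(y) m(Q)⁻², one for each adjacent system. By Tonelli, ‖f‖_{B_p}^p is therefore comparable to the
sum, over all cubes of all systems, of the double averages ⨍_Q⨍_Q |f(x)-f(y)|^p. The kernel
comparison is `exists_kernel_le` (any single system lies below the Besov kernel, because m(Q)⁻²
decays geometrically as Q grows around x and y) and `exists_le_sum_kernel` (some adjacent cube of
size about |x-y| contains both points).

It remains to compare the double averages with MO_Q(f)^p. Jensen's inequality gives MO_Q(f)^p ≤
⨍_Q⨍_Q |f(x)-f(y)|^p. The reverse inequality fails cube by cube but holds after summation over Q
(`exists_tsum_osc_rpow_le`): for almost every x, Lebesgue differentiation and telescoping bound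
|f(x) - ⟨f⟩_Q| by the sum of the mean oscillations over the cubes shrinking to x. Hölder's
inequality with geometric weights moves the p-th power inside that sum, and the weights are paid for
by the decay m(Q_j) ≤ A δ^j m(Q) of the measures of descendants.

Finally ℓ^{p,p} is ℓ^p, since rearrangement preserves the sum of p-th powers (`lorentzNorm_self`).
-/

namespace Bessel

/-! ### Measures of Bessel balls and dyadic cubes. -/

/-- The size `r^{n+1} (x_{n+1} + r)^{2 lam}` of the measure of a Bessel ball. -/
noncomputable def ballSize {n : ℕ} (lam : ℝ) (x : Space n) (r : ℝ) : ℝ :=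
  r ^ (n + 1) * (x (Fin.last n) + r) ^ (2 * lam)

lemma isOpen_halfSpace (n : ℕ) : IsOpen (halfSpace n) :=
  isOpen_lt continuous_const (by fun_prop)

lemma abs_coord_sub_le_dist {n : ℕ} (x y : Space n) (i : Fin (n + 1)) :
    |x i - y i| ≤ dist x y := by
  rw [dist_eq_norm]
  exact PiLp.norm_apply_le (x - y) i

lemma measurableSet_besselBall {n : ℕ} (x : Space n) (r : ℝ) : MeasurableSet (besselBall x r) :=
  measurableSet_ball.inter (isOpen_halfSpace n).measurableSet

lemma besselMeasure_apply {n : ℕ} (lam : ℝ) {s : Set (Space n)} (hs : MeasurableSet s) :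
    besselMeasure n lam s =
      ∫⁻ x in s ∩ halfSpace n, ENNReal.ofReal (x (Fin.last n) ^ (2 * lam)) := by
  rw [besselMeasure, withDensity_apply _ hs, Measure.restrict_restrict hs]

lemma besselMeasure_ball {n : ℕ} (lam : ℝ) (x : Space n) (r : ℝ) :
    besselMeasure n lam (Metric.ball x r) = besselMeasure n lam (besselBall x r) := by
  rw [besselMeasure_apply lam measurableSet_ball,
    besselMeasure_apply lam (measurableSet_besselBall x r), besselBall, inter_assoc, inter_self]

lemma volume_ball_eq {n : ℕ} (x : Space n) {r : ℝ} (hr : 0 ≤ r) :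
    volume (Metric.ball x r) =
      ENNReal.ofReal (r ^ (n + 1)) * volume (Metric.ball (0 : Space n) 1) := by
  simpa using Measure.addHaar_ball (volume : Measure (Space n)) x hr

lemma besselMeasure_ball_le {n : ℕ} {lam : ℝ} (hlam : 0 < lam) (x : Space n) {r : ℝ}
    (hr : 0 ≤ r) :
    besselMeasure n lam (besselBall x r) ≤
      volume (Metric.ball (0 : Space n) 1) * ENNReal.ofReal (ballSize lam x r) := by
  rw [besselMeasure_apply lam (measurableSet_besselBall x r)]
  calc ∫⁻ y in besselBall x r ∩ halfSpace n, ENNReal.ofReal (y (Fin.last n) ^ (2 * lam))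
      ≤ ∫⁻ _ in besselBall x r ∩ halfSpace n,
          ENNReal.ofReal ((x (Fin.last n) + r) ^ (2 * lam)) := by
        refine setLIntegral_mono' ((measurableSet_besselBall x r).inter
          (isOpen_halfSpace n).measurableSet) fun y hy => ?_
        have h1 : 0 < y (Fin.last n) := hy.2
        have h2 := abs_le.1 (abs_coord_sub_le_dist y x (Fin.last n))
        have h3 : dist y x < r := hy.1.1
        gcongr
        linarith [h2.2]
    _ = ENNReal.ofReal ((x (Fin.last n) + r) ^ (2 * lam)) *
          volume (besselBall x r ∩ halfSpace n) := by
        rw [setLIntegral_const]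
    _ ≤ ENNReal.ofReal ((x (Fin.last n) + r) ^ (2 * lam)) * volume (Metric.ball x r) := by
        gcongr
        exact fun y hy => hy.1.1
    _ = _ := by
        rw [volume_ball_eq x hr, ballSize, ENNReal.ofReal_mul (by positivity)]
        ring

/-- Move the centre up by r/2. The ball of radius r/4 about the new point stays inside B(x,r), and
its points have height at least x_{n+1} + r/4 ≥ (x_{n+1} + r)/4, so the weight there is as large as
required even when x is close to the boundary. -/
lemma ballSize_le_besselMeasure {n : ℕ} {lam : ℝ} (hlam : 0 < lam) {x : Space n}
    (hx : x ∈ halfSpace n) {r : ℝ} (hr : 0 < r) :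
    ENNReal.ofReal ((1 / 4) ^ (n + 1) * (1 / 4) ^ (2 * lam)) *
      volume (Metric.ball (0 : Space n) 1) * ENNReal.ofReal (ballSize lam x r) ≤
      besselMeasure n lam (besselBall x r) := by
  have hx' : 0 < x (Fin.last n) := hx
  set z : Space n := x + EuclideanSpace.single (Fin.last n) (r / 2) with hz
  have hzl : z (Fin.last n) = x (Fin.last n) + r / 2 := by simp [hz]
  have hzd : dist z x = r / 2 := by
    rw [dist_eq_norm, hz]
    simp [abs_of_pos hr]
  have hmem : ∀ y ∈ Metric.ball z (r / 4), x (Fin.last n) + r / 4 ≤ y (Fin.last n) := by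
    intro y hy
    have h2 := abs_le.1 (abs_coord_sub_le_dist y z (Fin.last n))
    have h3 : dist y z < r / 4 := hy
    linarith [h2.1]
  have hsub : Metric.ball z (r / 4) ⊆ besselBall x r ∩ halfSpace n := by
    intro y hy
    have h1 := hmem y hy
    have h3 : dist y z < r / 4 := hy
    have h4 : y ∈ halfSpace n := show 0 < y (Fin.last n) by linarith
    refine ⟨⟨?_, h4⟩, h4⟩
    rw [Metric.mem_ball]
    linarith [dist_triangle y z x]
  rw [besselMeasure_apply lam (measurableSet_besselBall x r)]
  calc ENNReal.ofReal ((1 / 4) ^ (n + 1) * (1 / 4) ^ (2 * lam)) *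
        volume (Metric.ball (0 : Space n) 1) * ENNReal.ofReal (ballSize lam x r)
      = ENNReal.ofReal (((x (Fin.last n) + r) / 4) ^ (2 * lam)) *
          volume (Metric.ball z (r / 4)) := by
        rw [volume_ball_eq z (by positivity), mul_right_comm, ← mul_assoc,
          ← ENNReal.ofReal_mul (by positivity), ← ENNReal.ofReal_mul (by positivity)]
        congr 2
        rw [ballSize, div_eq_mul_one_div (x (Fin.last n) + r),
          Real.mul_rpow (by positivity) (by positivity), div_eq_mul_one_div r, mul_pow]
        ring
    _ = ∫⁻ _ in Metric.ball z (r / 4),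
          ENNReal.ofReal (((x (Fin.last n) + r) / 4) ^ (2 * lam)) := by
        rw [setLIntegral_const]
    _ ≤ ∫⁻ y in Metric.ball z (r / 4), ENNReal.ofReal (y (Fin.last n) ^ (2 * lam)) := by
        refine setLIntegral_mono' measurableSet_ball fun y hy => ?_
        have h1 := hmem y hy
        gcongr
        linarith
    _ ≤ _ := lintegral_mono_set hsub

/-- The measure of a Bessel ball is comparable to `ballSize`. -/
lemma exists_besselMeasure_besselBall_bounds (n : ℕ) {lam : ℝ} (hlam : 0 < lam) :
    ∃ A : ℝ≥0, ∀ x ∈ halfSpace n, ∀ r : ℝ, 0 < r →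
      besselMeasure n lam (besselBall x r) ≤ A * ENNReal.ofReal (ballSize lam x r) ∧
      ENNReal.ofReal (ballSize lam x r) ≤ A * besselMeasure n lam (besselBall x r) := by
  set v := volume (Metric.ball (0 : Space n) 1) with hv
  have hv0 : v ≠ 0 := (Metric.measure_ball_pos _ _ one_pos).ne'
  have hv1 : v ≠ ∞ := measure_ball_lt_top.ne
  set c := ENNReal.ofReal ((1 / 4) ^ (n + 1) * (1 / 4) ^ (2 * lam)) * v with hc
  have hc0 : c ≠ 0 := mul_ne_zero (ENNReal.ofReal_pos.2 (by positivity)).ne' hv0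
  have hc1 : c ≠ ∞ := ENNReal.mul_ne_top ENNReal.ofReal_ne_top hv1
  refine ⟨v.toNNReal + (c⁻¹).toNNReal, fun x hx r hr => ⟨?_, ?_⟩⟩
  · refine (besselMeasure_ball_le hlam x hr.le).trans ?_
    gcongr
    rw [ENNReal.coe_add, ENNReal.coe_toNNReal hv1]
    exact le_self_add
  · calc ENNReal.ofReal (ballSize lam x r)
        = c⁻¹ * (c * ENNReal.ofReal (ballSize lam x r)) := by
          rw [← mul_assoc, ENNReal.inv_mul_cancel hc0 hc1, one_mul]
      _ ≤ c⁻¹ * besselMeasure n lam (besselBall x r) := by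
          gcongr
          exact ballSize_le_besselMeasure hlam hx hr
      _ ≤ _ := by
          gcongr
          rw [ENNReal.coe_add, ENNReal.coe_toNNReal (ENNReal.inv_ne_top.2 hc0)]
          exact le_add_self

lemma ballSize_pos {n : ℕ} (lam : ℝ) {x : Space n} (hx : x ∈ halfSpace n) {r : ℝ} (hr : 0 < r) :
    0 < ballSize lam x r := by
  have hx' : 0 < x (Fin.last n) := hx
  unfold ballSize
  positivity

/-- One factor s/r is extracted from s^{n+1}. This first-order decay suffices for every geometric
series over scales below, including when n = 0. -/
lemma ballSize_le_mul {n : ℕ} {lam : ℝ} (hlam : 0 < lam) {x : Space n} (hx : x ∈ halfSpace n)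
    {s r : ℝ} (hs : 0 < s) (hsr : s ≤ r) : ballSize lam x s ≤ s / r * ballSize lam x r := by
  have hx' : 0 < x (Fin.last n) := hx
  have hr : 0 < r := hs.trans_le hsr
  have h1 : s ^ (n + 1) ≤ s / r * r ^ (n + 1) := by
    rw [pow_succ, pow_succ]
    have : s / r * (r ^ n * r) = r ^ n * s := by field_simp
    rw [this]
    gcongr
  unfold ballSize
  rw [← mul_assoc]
  gcongr

/-- Change of centre and radius in `ballSize`. -/
lemma ballSize_le_of_dist_le {n : ℕ} {lam : ℝ} (hlam : 0 < lam) {x y : Space n}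
    (hx : x ∈ halfSpace n) (hy : y ∈ halfSpace n) {r s K : ℝ} (hr : 0 < r) (hs : 0 < s)
    (hK : 1 ≤ K) (hrs : r ≤ K * s) (hxy : dist x y + r ≤ K * s) :
    ballSize lam x r ≤ K ^ (n + 1) * K ^ (2 * lam) * ballSize lam y s := by
  have hx' : 0 < x (Fin.last n) := hx
  have hy' : 0 < y (Fin.last n) := hy
  have h2 := (abs_le.1 (abs_coord_sub_le_dist x y (Fin.last n))).2
  have h3 : x (Fin.last n) + r ≤ K * (y (Fin.last n) + s) := by nlinarith
  unfold ballSize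
  calc r ^ (n + 1) * (x (Fin.last n) + r) ^ (2 * lam)
      ≤ (K * s) ^ (n + 1) * (K * (y (Fin.last n) + s)) ^ (2 * lam) := by gcongr
    _ = _ := by
      rw [mul_pow, Real.mul_rpow (by positivity) (by positivity)]
      ring

namespace DyadicSystem

variable {n : ℕ} {δ : ℝ}

lemma cube_subset_halfSpace (D : DyadicSystem n δ) (k : ℤ) (α : D.A k) :
    D.cube k α ⊆ halfSpace n := fun _ hx => (D.subset_ball k α hx).2

lemma dist_lt (D : DyadicSystem n δ) {k : ℤ} {α : D.A k} {x y : Space n} (hx : x ∈ D.cube k α)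
    (hy : y ∈ D.cube k α) : dist x y < 8 * δ ^ k := by
  have h1 : dist x (D.center k α) < 4 * δ ^ k := (D.subset_ball k α hx).1
  have h2 : dist y (D.center k α) < 4 * δ ^ k := (D.subset_ball k α hy).1
  linarith [dist_triangle_right x y (D.center k α)]

end DyadicSystem

/-- The measure of a dyadic cube is comparable to `ballSize` at any of its points. -/
lemma exists_besselMeasure_cube_bounds (n : ℕ) {lam : ℝ} (hlam : 0 < lam) {δ : ℝ} (hδ : 0 < δ) :
    ∃ A : ℝ≥0, ∀ (D : DyadicSystem n δ) (k : ℤ) (α : D.A k), ∀ x ∈ D.cube k α,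
      besselMeasure n lam (D.cube k α) ≤ A * ENNReal.ofReal (ballSize lam x (δ ^ k)) ∧
      ENNReal.ofReal (ballSize lam x (δ ^ k)) ≤ A * besselMeasure n lam (D.cube k α) := by
  obtain ⟨A, hA⟩ := exists_besselMeasure_besselBall_bounds n hlam
  -- The larger requirement on 60 comes from the inner ball: 4δ^k + δ^k = 60 · (δ^k/12).
  set K : ℝ := 60 ^ (n + 1) * 60 ^ (2 * lam) with hK
  have hK0 : 0 ≤ K := by positivity
  refine ⟨A * K.toNNReal, fun D k α x hx => ?_⟩
  have hδk : 0 < δ ^ k := zpow_pos hδ k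
  have hxH := D.cube_subset_halfSpace k α hx
  have hcH := D.cube_subset_halfSpace k α (D.center_mem k α)
  have hd : dist x (D.center k α) < 4 * δ ^ k := (D.subset_ball k α hx).1
  have key : ∀ {y z : Space n} {r s : ℝ}, ballSize lam y r ≤ K * ballSize lam z s →
      ENNReal.ofReal (ballSize lam y r) ≤ K.toNNReal * ENNReal.ofReal (ballSize lam z s) := by
    intro y z r s h
    rw [← ENNReal.ofReal, ← ENNReal.ofReal_mul hK0]
    exact ENNReal.ofReal_le_ofReal h
  constructor
  · calc besselMeasure n lam (D.cube k α)
        ≤ besselMeasure n lam (besselBall (D.center k α) (4 * δ ^ k)) :=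
          measure_mono (D.subset_ball k α)
      _ ≤ A * ENNReal.ofReal (ballSize lam (D.center k α) (4 * δ ^ k)) :=
          (hA _ hcH _ (by positivity)).1
      _ ≤ A * (K.toNNReal * ENNReal.ofReal (ballSize lam x (δ ^ k))) := by
          gcongr
          refine key (ballSize_le_of_dist_le hlam hcH hxH (by positivity) hδk (by norm_num)
            (by linarith) ?_)
          rw [dist_comm]; linarith
      _ = _ := by push_cast; ring
  · calc ENNReal.ofReal (ballSize lam x (δ ^ k))
        ≤ K.toNNReal * ENNReal.ofReal (ballSize lam (D.center k α) (1 / 12 * δ ^ k)) := by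
          refine key (ballSize_le_of_dist_le hlam hxH hcH hδk (by positivity) (by norm_num)
            (by linarith) (by linarith))
      _ ≤ K.toNNReal * (A * besselMeasure n lam (besselBall (D.center k α) (1 / 12 * δ ^ k))) := by
          gcongr
          exact (hA _ hcH _ (by positivity)).2
      _ ≤ K.toNNReal * (A * besselMeasure n lam (D.cube k α)) := by
          gcongr
          exact D.ball_subset k α
      _ = _ := by push_cast; ring

/-! ### Rearrangements, and the identity of ℓ^{p,p} with ℓ^p. -/

/-- If more than k values exceed t, choose k+1 of them: their minimum still exceeds t, and no level
below that minimum is admissible in the infimum. Finiteness of the choice is what keeps the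
inequality strict. -/
lemma lt_rearrangement_iff {ι : Type*} (a : ι → ℝ≥0∞) (k : ℕ) (t : ℝ≥0∞) :
    t < rearrangement a k ↔ (k : ℕ∞) < {i | t < a i}.encard := by
  constructor
  · intro h
    by_contra! hle
    exact absurd (sInf_le (show t ∈ {t : ℝ≥0∞ | {i | t < a i}.encard ≤ k} from hle)) h.not_ge
  · intro h
    obtain ⟨s, hs, hcard⟩ := Set.exists_subset_encard_eq
      (show ((k + 1 : ℕ) : ℕ∞) ≤ {i | t < a i}.encard by
        push_cast; exact Order.add_one_le_of_lt h)
    have hfin : s.Finite := Set.finite_of_encard_eq_coe hcard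
    have hne : s.Nonempty := by
      rw [← Set.encard_ne_zero, hcard]; simp
    obtain ⟨i, his, hi⟩ := hfin.exists_minimalFor a s hne
    have hi' : ∀ j ∈ s, a i ≤ a j := fun j hj => by
      rcases le_total (a i) (a j) with h | h
      · exact h
      · exact hi hj h
    refine lt_of_lt_of_le (hs his) (le_sInf fun u hu => ?_)
    by_contra! hlt
    have : ((k + 1 : ℕ) : ℕ∞) ≤ k := by
      rw [← hcard]
      exact (Set.encard_le_encard fun j hj => hlt.trans_le (hi' j hj)).trans hu
    norm_cast at this
    omega

lemma encard_lt_rearrangement {ι : Type*} (a : ι → ℝ≥0∞) (t : ℝ≥0∞) :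
    {k : ℕ | t < rearrangement a k}.encard = {i | t < a i}.encard := by
  simp only [lt_rearrangement_iff]
  generalize {i | t < a i}.encard = N
  induction N using ENat.recTopCoe with
  | top => simp
  | coe N =>
    have : {k : ℕ | (k : ℕ∞) < N} = (Finset.range N : Set ℕ) := by ext; simp
    rw [this, Set.encard_coe_eq_coe_finsetCard, Finset.card_range]

/-- Layer-cake formula: a sum depends only on the distribution function of the family, which a
family shares with its rearrangement. -/
lemma tsum_eq_lintegral_encard {ι : Type*} [Countable ι] (a : ι → ℝ≥0∞) :
    ∑' i, a i = ∫⁻ t in Ioi (0 : ℝ), ({i | ENNReal.ofReal t < a i}.encard : ℝ≥0∞) := by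
  have h1 : ∀ b : ℝ≥0∞, b = ∫⁻ t in Ioi (0 : ℝ), {t : ℝ | ENNReal.ofReal t < b}.indicator 1 t := by
    intro b
    have hm : MeasurableSet {t : ℝ | ENNReal.ofReal t < b} :=
      measurableSet_lt ENNReal.measurable_ofReal measurable_const
    rw [lintegral_indicator_one hm, Measure.restrict_apply hm]
    rcases eq_or_ne b ∞ with rfl | hb
    · simp
    · have : {t : ℝ | ENNReal.ofReal t < b} ∩ Ioi 0 = Ioo 0 b.toReal := by
        ext t
        simp only [mem_inter_iff, mem_ofPred_eq, mem_Ioi, mem_Ioo]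
        constructor
        · rintro ⟨h, h0⟩
          exact ⟨h0, (ENNReal.ofReal_lt_iff_lt_toReal h0.le hb).1 h⟩
        · rintro ⟨h0, h⟩
          exact ⟨(ENNReal.ofReal_lt_iff_lt_toReal h0.le hb).2 h, h0⟩
      rw [this, Real.volume_Ioo, sub_zero, ENNReal.ofReal_toReal hb]
  calc ∑' i, a i
      = ∑' i, ∫⁻ t in Ioi (0 : ℝ), {t : ℝ | ENNReal.ofReal t < a i}.indicator 1 t :=
        tsum_congr fun i => h1 (a i)
    _ = ∫⁻ t in Ioi (0 : ℝ), ∑' i, {t : ℝ | ENNReal.ofReal t < a i}.indicator 1 t := by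
        rw [lintegral_tsum]
        exact fun i => (measurable_one.indicator
          (measurableSet_lt ENNReal.measurable_ofReal measurable_const)).aemeasurable
    _ = _ := by
        congr 1 with t
        rw [← ENNReal.tsum_set_one, tsum_subtype {i | ENNReal.ofReal t < a i} fun _ => (1 : ℝ≥0∞)]
        rfl

lemma tsum_rearrangement_rpow {ι : Type*} [Countable ι] (a : ι → ℝ≥0∞) {p : ℝ} (hp : 0 < p) :
    ∑' k, rearrangement a k ^ p = ∑' i, a i ^ p := by
  rw [tsum_eq_lintegral_encard, tsum_eq_lintegral_encard]
  congr 1 with t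
  have h : ∀ b : ℝ≥0∞, ENNReal.ofReal t < b ^ p ↔ ENNReal.ofReal t ^ p⁻¹ < b := fun b => by
    rw [ENNReal.rpow_inv_lt_iff hp]
  simp only [h, encard_lt_rearrangement]

lemma lorentzNorm_self {ι : Type*} [Countable ι] (a : ι → ℝ≥0∞) {p : ℝ} (hp : 0 < p) :
    lorentzNorm p (ENNReal.ofReal p) a = (∑' i, a i ^ p) ^ (1 / p) := by
  rw [lorentzNorm, if_neg ENNReal.ofReal_ne_top, ENNReal.toReal_ofReal hp.le, div_self hp.ne',
    sub_self, ← tsum_rearrangement_rpow a hp]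
  simp

/-! ### Oscillations and double averages on a probability space; a weighted Hölder inequality. -/

section ProbabilitySpace

variable {Ω : Type*} [MeasurableSpace Ω]

lemma lintegral_rpow_le_of_isProbabilityMeasure (P : Measure Ω) [IsProbabilityMeasure P] {p : ℝ}
    (hp : 1 < p) {g : Ω → ℝ≥0∞} (hg : AEMeasurable g P) :
    (∫⁻ x, g x ∂P) ^ p ≤ ∫⁻ x, g x ^ p ∂P := by
  have hq := Real.HolderConjugate.conjExponent hp
  have h := ENNReal.lintegral_mul_le_Lp_mul_Lq P hq hg (aemeasurable_const (b := (1 : ℝ≥0∞)))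
  simp only [Pi.mul_apply, mul_one, ENNReal.one_rpow, lintegral_const, measure_univ] at h
  calc (∫⁻ x, g x ∂P) ^ p ≤ ((∫⁻ x, g x ^ p ∂P) ^ (1 / p)) ^ p := by gcongr
    _ = _ := by
      rw [← ENNReal.rpow_mul, one_div_mul_cancel (by positivity), ENNReal.rpow_one]

/-- The mean oscillation is dominated by the `p`-th power double average. -/
lemma lintegral_sub_integral_rpow_le (P : Measure Ω) [IsProbabilityMeasure P] {p : ℝ}
    (hp : 1 < p) {f : Ω → ℂ} (hf : Measurable f) :
    (∫⁻ x, ‖f x - ∫ z, f z ∂P‖ₑ ∂P) ^ p ≤ ∫⁻ x, ∫⁻ y, ‖f x - f y‖ₑ ^ p ∂P ∂P := by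
  have hm : Measurable (Function.uncurry fun x y => ‖f x - f y‖ₑ) :=
    ((hf.comp measurable_fst).sub (hf.comp measurable_snd)).enorm
  have hJ : (∫⁻ x, ∫⁻ y, ‖f x - f y‖ₑ ∂P ∂P) ^ p ≤ ∫⁻ x, ∫⁻ y, ‖f x - f y‖ₑ ^ p ∂P ∂P :=
    (lintegral_rpow_le_of_isProbabilityMeasure P hp
      hm.lintegral_prod_right'.aemeasurable).trans <| lintegral_mono fun x =>
        lintegral_rpow_le_of_isProbabilityMeasure P hp (hf.const_sub (f x)).enorm.aemeasurable
  refine le_trans ?_ hJ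
  gcongr ?_ ^ _
  -- When the double integral is finite, one good x₀ makes f integrable. This is needed because the
  -- Bochner integral of a non-integrable f is 0 by default and is then no longer an average.
  rcases eq_or_ne (∫⁻ x, ∫⁻ y, ‖f x - f y‖ₑ ∂P ∂P) ∞ with htop | hfin
  · rw [htop]; exact le_top
  · have hae := ae_lt_top hm.lintegral_prod_right' hfin
    obtain ⟨x₀, hx₀⟩ := hae.exists
    have hi0 : Integrable (fun y => f x₀ - f y) P :=
      ⟨(hf.const_sub (f x₀)).aestronglyMeasurable, hx₀⟩
    have hint : Integrable f P := by
      refine ((integrable_const (f x₀)).sub hi0).congr (ae_of_all _ fun y => ?_)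
      simp
    refine lintegral_mono fun x => ?_
    have : f x - ∫ z, f z ∂P = ∫ y, (f x - f y) ∂P := by
      rw [integral_sub (integrable_const _) hint]; simp
    rw [this]
    exact enorm_integral_le_lintegral_enorm _

/-- The double average is dominated by the oscillation about any constant. -/
lemma lintegral_lintegral_sub_rpow_le (P : Measure Ω) [IsProbabilityMeasure P] {p : ℝ}
    (hp : 1 ≤ p) {f : Ω → ℂ} (hf : Measurable f) (c : ℂ) :
    ∫⁻ x, ∫⁻ y, ‖f x - f y‖ₑ ^ p ∂P ∂P ≤ 2 ^ p * ∫⁻ x, ‖f x - c‖ₑ ^ p ∂P := by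
  set g : Ω → ℝ≥0∞ := fun x => ‖f x - c‖ₑ ^ p with hg
  have hgm : Measurable g := ((hf.sub_const c).enorm).pow_const p
  have hpt : ∀ x y, ‖f x - f y‖ₑ ^ p ≤ 2 ^ (p - 1) * (g x + g y) := fun x y => by
    refine le_trans ?_ (ENNReal.rpow_add_le_mul_rpow_add_rpow _ _ hp)
    gcongr
    calc ‖f x - f y‖ₑ = ‖(f x - c) - (f y - c)‖ₑ := by congr 1; ring
      _ ≤ _ := enorm_sub_le
  calc ∫⁻ x, ∫⁻ y, ‖f x - f y‖ₑ ^ p ∂P ∂P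
      ≤ ∫⁻ x, ∫⁻ y, 2 ^ (p - 1) * (g x + g y) ∂P ∂P :=
        lintegral_mono fun x => lintegral_mono fun y => hpt x y
    _ = 2 ^ (p - 1) * (∫⁻ x, g x ∂P + ∫⁻ x, g x ∂P) := by
        have h2 : ∀ x, ∫⁻ y, 2 ^ (p - 1) * (g x + g y) ∂P =
            2 ^ (p - 1) * (g x + ∫⁻ y, g y ∂P) := fun x => by
          rw [lintegral_const_mul _ (by fun_prop), lintegral_add_left (by fun_prop)]; simp
        simp only [h2]
        rw [lintegral_const_mul _ (by fun_prop), lintegral_add_left hgm]; simp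
    _ = 2 ^ p * ∫⁻ x, g x ∂P := by
        rw [← two_mul, ← mul_assoc]
        congr 1
        conv_rhs => rw [show p = (p - 1) + 1 by ring,
          ENNReal.rpow_add _ _ two_ne_zero ENNReal.ofNat_ne_top, ENNReal.rpow_one]

end ProbabilitySpace

/-- Hölder's inequality for a series with geometric weights. -/
lemma tsum_rpow_le_geometric {p : ℝ} (hp : 1 < p) {θ : ℝ≥0∞} (hθ0 : θ ≠ 0) (hθ1 : θ < 1) :
    ∃ C : ℝ≥0, ∀ a : ℕ → ℝ≥0∞, (∑' j, a j) ^ p ≤ C * ∑' j, (θ⁻¹) ^ j * a j ^ p := by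
  have hpq := Real.HolderConjugate.conjExponent hp
  set q := p.conjExponent with hq
  have hp0 : 0 < p := by linarith
  have hθt : θ ≠ ∞ := (hθ1.trans ENNReal.one_lt_top).ne
  -- Writing a_j = θ^{j/p} · θ^{-j/p} a_j, Hölder's inequality leaves the q-th powers θ^{jq/p} = τ^j
  -- of the weights, a convergent geometric series.
  set τ := θ ^ (q / p) with hτ
  have hτ1 : τ < 1 := ENNReal.rpow_lt_one hθ1 (div_pos hpq.symm.pos hp0)
  set B := (∑' j : ℕ, τ ^ j) ^ (1 / q) with hB
  have hBt : B ≠ ∞ := by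
    refine ENNReal.rpow_ne_top_of_nonneg (by have := hpq.symm.pos; positivity) ?_
    rw [ENNReal.tsum_geometric]
    exact ENNReal.inv_ne_top.2 (tsub_pos_of_lt hτ1).ne'
  refine ⟨(B ^ p).toNNReal, fun a => ?_⟩
  rw [ENNReal.coe_toNNReal (ENNReal.rpow_ne_top_of_nonneg hp0.le hBt)]
  have hfin : ∀ s : Finset ℕ, (∑ j ∈ s, a j) ≤ B * (∑' j, (θ⁻¹) ^ j * a j ^ p) ^ (1 / p) := by
    intro s
    have hsplit : ∀ j, a j = (θ ^ (1 / p)) ^ j * ((θ⁻¹ ^ (1 / p)) ^ j * a j) := fun j => by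
      rw [← mul_assoc, ← mul_pow, ← ENNReal.mul_rpow_of_nonneg _ _ (by positivity),
        ENNReal.mul_inv_cancel hθ0 hθt, ENNReal.one_rpow, one_pow, one_mul]
    calc ∑ j ∈ s, a j = ∑ j ∈ s, (θ ^ (1 / p)) ^ j * ((θ⁻¹ ^ (1 / p)) ^ j * a j) :=
          Finset.sum_congr rfl fun j _ => hsplit j
      _ ≤ (∑ j ∈ s, ((θ ^ (1 / p)) ^ j) ^ q) ^ (1 / q) *
            (∑ j ∈ s, ((θ⁻¹ ^ (1 / p)) ^ j * a j) ^ p) ^ (1 / p) :=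
          ENNReal.inner_le_Lp_mul_Lq s _ _ hpq.symm
      _ = (∑ j ∈ s, τ ^ j) ^ (1 / q) * (∑ j ∈ s, (θ⁻¹) ^ j * a j ^ p) ^ (1 / p) := by
          congr 2
          · refine Finset.sum_congr rfl fun j _ => ?_
            rw [hτ]
            simp only [← ENNReal.rpow_natCast, ← ENNReal.rpow_mul]
            congr 1; ring
          · refine Finset.sum_congr rfl fun j _ => ?_
            rw [ENNReal.mul_rpow_of_nonneg _ _ hp0.le]
            simp only [← ENNReal.rpow_natCast, ← ENNReal.rpow_mul]
            congr 2; field_simp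
      _ ≤ _ := by
          rw [hB]
          have := hpq.symm.pos
          gcongr <;> exact ENNReal.sum_le_tsum _
  calc (∑' j, a j) ^ p ≤ (B * (∑' j, (θ⁻¹) ^ j * a j ^ p) ^ (1 / p)) ^ p := by
        gcongr
        rw [ENNReal.tsum_eq_iSup_sum]
        exact iSup_le hfin
    _ = _ := by
        rw [ENNReal.mul_rpow_of_nonneg _ _ hp0.le, ← ENNReal.rpow_mul _ (1 / p) p,
          one_div_mul_cancel hp0.ne', ENNReal.rpow_one]

/-! ### Averages over cubes and the dyadic kernel. -/

instance (n : ℕ) (lam : ℝ) : SFinite (besselMeasure n lam) := by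
  unfold besselMeasure; infer_instance

/-- The probability measure proportional to the Bessel measure on `E`. -/
noncomputable def normalizedMeasure {n : ℕ} (lam : ℝ) (E : Set (Space n)) : Measure (Space n) :=
  (besselMeasure n lam E)⁻¹ • (besselMeasure n lam).restrict E

lemma meanOsc_eq {n : ℕ} (lam : ℝ) (f : Space n → ℂ) (E : Set (Space n)) :
    meanOsc lam f E = ∫⁻ x, ‖f x - ∫ z, f z ∂normalizedMeasure lam E‖ₑ
      ∂normalizedMeasure lam E := by
  simp only [meanOsc, laverage, average, normalizedMeasure, Measure.restrict_apply_univ]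

lemma lintegral_normalizedMeasure {n : ℕ} (lam : ℝ) (E : Set (Space n)) (g : Space n → ℝ≥0∞) :
    ∫⁻ x, g x ∂normalizedMeasure lam E =
      (besselMeasure n lam E)⁻¹ * ∫⁻ x in E, g x ∂besselMeasure n lam := by
  rw [normalizedMeasure, lintegral_smul_measure, smul_eq_mul]

lemma isProbabilityMeasure_normalizedMeasure {n : ℕ} {lam : ℝ} {E : Set (Space n)}
    (h0 : besselMeasure n lam E ≠ 0) (h1 : besselMeasure n lam E ≠ ∞) :
    IsProbabilityMeasure (normalizedMeasure lam E) := by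
  refine ⟨?_⟩
  rw [normalizedMeasure, Measure.smul_apply, Measure.restrict_apply_univ, smul_eq_mul,
    ENNReal.inv_mul_cancel h0 h1]

lemma inv_le_mul_inv_of_le_mul {a b A : ℝ≥0∞} (ha : a ≠ 0) (hA : A ≠ ∞) (h : a ≤ A * b) :
    b⁻¹ ≤ A * a⁻¹ := by
  have hA0 : A ≠ 0 := by rintro rfl; simp_all
  calc b⁻¹ = A * (A * b)⁻¹ := by
        rw [ENNReal.mul_inv (Or.inl hA0) (Or.inl hA), ← mul_assoc, ENNReal.mul_inv_cancel hA0 hA,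
          one_mul]
    _ ≤ A * a⁻¹ := by gcongr

lemma besselMeasure_besselBall_ne_zero {n : ℕ} {lam : ℝ} (hlam : 0 < lam) {x : Space n}
    (hx : x ∈ halfSpace n) {r : ℝ} (hr : 0 < r) : besselMeasure n lam (besselBall x r) ≠ 0 := by
  obtain ⟨A, hA⟩ := exists_besselMeasure_besselBall_bounds n hlam
  intro h
  have := (hA x hx r hr).2
  rw [h, mul_zero, nonpos_iff_eq_zero, ENNReal.ofReal_eq_zero] at this
  exact this.not_gt (ballSize_pos lam hx hr)

namespace DyadicSystem

variable {n : ℕ} {δ : ℝ}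

instance (D : DyadicSystem n δ) (k : ℤ) : Countable (D.A k) := D.countable_index k

lemma exists_mem_cube (D : DyadicSystem n δ) {x : Space n} (hx : x ∈ halfSpace n) (k : ℤ) :
    ∃ α, x ∈ D.cube k α := by
  rw [← D.iUnion_cube k] at hx
  exact mem_iUnion.1 hx

lemma eq_of_mem_cube (D : DyadicSystem n δ) {x : Space n} {k : ℤ} {α β : D.A k}
    (hα : x ∈ D.cube k α) (hβ : x ∈ D.cube k β) : α = β := by
  by_contra h
  exact (D.disjoint_cube k α β h).le_bot ⟨hα, hβ⟩

lemma cube_subset_cube (D : DyadicSystem n δ) {x : Space n} {k l : ℤ} (hkl : k ≤ l) {α : D.A k}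
    {β : D.A l} (hα : x ∈ D.cube k α) (hβ : x ∈ D.cube l β) : D.cube l β ⊆ D.cube k α :=
  (D.nested k l α β hkl).resolve_right fun h => h.le_bot ⟨hα, hβ⟩

lemma besselMeasure_cube_ne_zero (D : DyadicSystem n δ) (hδ : 0 < δ) {lam : ℝ} (hlam : 0 < lam)
    (k : ℤ) (α : D.A k) : besselMeasure n lam (D.cube k α) ≠ 0 := by
  have h := besselMeasure_besselBall_ne_zero hlam
    (D.cube_subset_halfSpace k α (D.center_mem k α)) (r := 1 / 12 * δ ^ k) (by positivity)
  exact fun h0 => h (measure_mono_null (D.ball_subset k α) h0)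

lemma besselMeasure_cube_ne_top (D : DyadicSystem n δ) (hδ : 0 < δ) {lam : ℝ} (hlam : 0 < lam)
    (k : ℤ) (α : D.A k) : besselMeasure n lam (D.cube k α) ≠ ∞ := by
  obtain ⟨A, hA⟩ := exists_besselMeasure_cube_bounds n hlam hδ
  exact ((hA D k α _ (D.center_mem k α)).1.trans_lt
    (ENNReal.mul_lt_top ENNReal.coe_lt_top ENNReal.ofReal_lt_top)).ne

lemma isProbabilityMeasure_normalizedMeasure (D : DyadicSystem n δ) (hδ : 0 < δ) {lam : ℝ}
    (hlam : 0 < lam) (k : ℤ) (α : D.A k) :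
    IsProbabilityMeasure (normalizedMeasure lam (D.cube k α)) :=
  Bessel.isProbabilityMeasure_normalizedMeasure (D.besselMeasure_cube_ne_zero hδ hlam k α)
    (D.besselMeasure_cube_ne_top hδ hlam k α)

/-- The cubes of all generations. -/
abbrev Index (D : DyadicSystem n δ) : Type := Σ k : ℤ, D.A k

/-- The kernel `∑_Q 1_Q(x) 1_Q(y) / m_lam(Q)^2`. -/
noncomputable def kernel (D : DyadicSystem n δ) (lam : ℝ) (x y : Space n) : ℝ≥0∞ :=
  ∑' Q : D.Index, (D.cube Q.1 Q.2).indicator 1 x * (D.cube Q.1 Q.2).indicator 1 y *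
    (besselMeasure n lam (D.cube Q.1 Q.2))⁻¹ ^ 2

/-- Tonelli's theorem. This is the passage between sums over cubes and Besov-type double integrals,
and it is used in both directions of the equivalence. -/
lemma tsum_lintegral_normalizedMeasure (D : DyadicSystem n δ) (lam : ℝ)
    {F : Space n → Space n → ℝ≥0∞} (hF : Measurable (Function.uncurry F)) :
    ∑' Q : D.Index, ∫⁻ x, ∫⁻ y, F x y ∂normalizedMeasure lam (D.cube Q.1 Q.2)
      ∂normalizedMeasure lam (D.cube Q.1 Q.2) =
    ∫⁻ x, ∫⁻ y, F x y * D.kernel lam x y ∂besselMeasure n lam ∂besselMeasure n lam := by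
  set m := besselMeasure n lam with hm
  set G : D.Index → Space n → Space n → ℝ≥0∞ := fun Q x y =>
    F x y * ((D.cube Q.1 Q.2).indicator 1 x * (D.cube Q.1 Q.2).indicator 1 y *
      (m (D.cube Q.1 Q.2))⁻¹ ^ 2) with hG
  have hI : ∀ Q : D.Index, Measurable ((D.cube Q.1 Q.2).indicator (1 : Space n → ℝ≥0∞)) :=
    fun Q => measurable_one.indicator (D.measurableSet_cube Q.1 Q.2)
  have hGm : ∀ Q, Measurable (Function.uncurry (G Q)) := fun Q =>
    hF.mul ((((hI Q).comp measurable_fst).mul ((hI Q).comp measurable_snd)).mul_const _)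
  calc ∑' Q : D.Index, ∫⁻ x, ∫⁻ y, F x y ∂normalizedMeasure lam (D.cube Q.1 Q.2)
        ∂normalizedMeasure lam (D.cube Q.1 Q.2)
      = ∑' Q : D.Index, ∫⁻ x, ∫⁻ y, G Q x y ∂m ∂m := by
        refine tsum_congr fun Q => ?_
        have hQ := D.measurableSet_cube Q.1 Q.2
        have h1 : ∀ x, ∫⁻ y, G Q x y ∂m = (m (D.cube Q.1 Q.2))⁻¹ *
            (D.cube Q.1 Q.2).indicator (fun x => (m (D.cube Q.1 Q.2))⁻¹ *
              ∫⁻ y in D.cube Q.1 Q.2, F x y ∂m) x := by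
          intro x
          have h2 : ∀ y, G Q x y = ((m (D.cube Q.1 Q.2))⁻¹ ^ 2 * (D.cube Q.1 Q.2).indicator 1 x) *
              (D.cube Q.1 Q.2).indicator (F x) y := by
            intro y
            simp only [hG]
            by_cases hy : y ∈ D.cube Q.1 Q.2
            · simp only [indicator_of_mem hy, Pi.one_apply]; ring
            · simp [indicator_of_notMem hy]
          simp only [h2]
          rw [lintegral_const_mul _ ((show Measurable (F x) from
              hF.comp measurable_prodMk_left).indicator hQ),
            lintegral_indicator hQ]
          by_cases hx : x ∈ D.cube Q.1 Q.2
          · simp only [indicator_of_mem hx, Pi.one_apply]; ring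
          · simp [indicator_of_notMem hx]
        simp only [h1, lintegral_normalizedMeasure]
        have h3 : Measurable fun x => (m (D.cube Q.1 Q.2))⁻¹ *
            ∫⁻ y in D.cube Q.1 Q.2, F x y ∂m := measurable_const.mul hF.lintegral_prod_right'
        rw [lintegral_const_mul _ (h3.indicator hQ), lintegral_indicator hQ]
    _ = ∫⁻ x, ∫⁻ y, ∑' Q : D.Index, G Q x y ∂m ∂m := by
        have h4 : ∀ Q, Measurable fun x => ∫⁻ y, G Q x y ∂m :=
          fun Q => (hGm Q).lintegral_prod_right'
        rw [← lintegral_tsum fun Q => (h4 Q).aemeasurable]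
        refine lintegral_congr fun x => ?_
        have h5 : ∀ Q, Measurable (G Q x) := fun Q => (hGm Q).comp measurable_prodMk_left
        rw [lintegral_tsum fun Q => (h5 Q).aemeasurable]
    _ = _ := by simp only [hG, ENNReal.tsum_mul_left, kernel]; rfl

end DyadicSystem

/-! ### Comparison of the Besov kernel with the dyadic kernels. -/

lemma tsum_zpow_ratio_le {δ : ℝ} (hδ0 : 0 < δ) (hδ1 : δ < 1) {t : ℝ} (ht : 0 < t) :
    ∑' k : ℤ, {k : ℤ | t < δ ^ k}.indicator (fun k => ENNReal.ofReal (t / δ ^ k)) k ≤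
      (1 - ENNReal.ofReal δ)⁻¹ := by
  obtain ⟨N, hN1, hN2⟩ := exists_mem_Ico_zpow ht (one_lt_inv₀ hδ0 |>.2 hδ1)
  rw [inv_zpow', ] at hN1 hN2
  -- K is the largest k with t < δ^k; its ratio is at most 1, and each coarser generation gains a
  -- factor δ.
  set K : ℤ := -(N + 1) with hK
  have hinj : Function.Injective fun j : ℕ => K - (j : ℤ) := fun i j h => by
    simp only at h; omega
  rw [← hinj.tsum_eq]
  · rw [← ENNReal.tsum_geometric]
    refine ENNReal.tsum_le_tsum fun j => ?_
    refine (indicator_le_self' (fun _ _ => zero_le) _).trans ?_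
    rw [← ENNReal.ofReal_pow hδ0.le]
    refine ENNReal.ofReal_le_ofReal ?_
    rw [div_le_iff₀ (by positivity), ← zpow_natCast, ← zpow_add₀ hδ0.ne']
    simpa using hN2.le
  · intro k hk
    have hk' : t < δ ^ k := by
      by_contra h
      exact hk (indicator_of_notMem (s := {k : ℤ | t < δ ^ k}) h _)
    have : k < -N + 0 := by
      have := (zpow_lt_zpow_iff_right_of_lt_one₀ hδ0 hδ1).1 (hN1.trans_lt hk')
      omega
    exact ⟨(K - k).toNat, by simp only; omega⟩

/-- The dyadic kernel is dominated by the Besov kernel. -/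
lemma exists_kernel_le (n : ℕ) {lam : ℝ} (hlam : 0 < lam) {δ : ℝ} (hδ0 : 0 < δ) (hδ1 : δ < 1) :
    ∃ A : ℝ≥0, ∀ (D : DyadicSystem n δ) (x y : Space n), x ≠ y →
      D.kernel lam x y ≤ A * (besselMeasure n lam (besselBall x (dist x y)))⁻¹ ^ 2 := by
  obtain ⟨A₁, hA₁⟩ := exists_besselMeasure_besselBall_bounds n hlam
  obtain ⟨A₂, hA₂⟩ := exists_besselMeasure_cube_bounds n hlam hδ0
  -- A cube of generation k containing x and y forces |x-y| < 8δ^k, hence the comparison of radius r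
  -- with r/8.
  set K : ℝ := 8 ^ (n + 1) * 8 ^ (2 * lam) with hK
  have hK0 : 0 ≤ K := by positivity
  set A : ℝ≥0 := A₁ * K.toNNReal * A₂ with hA
  have hSt : (1 - ENNReal.ofReal δ)⁻¹ ≠ ∞ := by
    refine ENNReal.inv_ne_top.2 (tsub_pos_of_lt ?_).ne'
    exact ENNReal.ofReal_lt_one.2 hδ1
  refine ⟨A ^ 2 * ((1 - ENNReal.ofReal δ)⁻¹).toNNReal, fun D x y hxy => ?_⟩
  set r := dist x y with hr
  have hr0 : 0 < r := dist_pos.2 hxy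
  set b := besselMeasure n lam (besselBall x r) with hb
  have hcube : ∀ (k : ℤ) (α : D.A k), x ∈ D.cube k α → y ∈ D.cube k α →
      (besselMeasure n lam (D.cube k α))⁻¹ ^ 2 ≤ A ^ 2 * b⁻¹ ^ 2 *
        {k : ℤ | r / 8 < δ ^ k}.indicator (fun k => ENNReal.ofReal (r / 8 / δ ^ k)) k := by
    intro k α hx hy
    have hxH := D.cube_subset_halfSpace k α hx
    have hlt : r / 8 < δ ^ k := by linarith [D.dist_lt hx hy]
    have hδk : 0 < δ ^ k := zpow_pos hδ0 k
    rw [indicator_of_mem (show k ∈ {k : ℤ | r / 8 < δ ^ k} from hlt)]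
    set ρ := ENNReal.ofReal (r / 8 / δ ^ k) with hρ
    have hρ1 : ρ ≤ 1 := by
      rw [hρ, ENNReal.ofReal_le_one, div_le_one hδk]; exact hlt.le
    have h1 : b ≤ A * ρ * besselMeasure n lam (D.cube k α) := by
      calc b ≤ A₁ * ENNReal.ofReal (ballSize lam x r) := (hA₁ x hxH r hr0).1
        _ ≤ A₁ * (K.toNNReal * (ρ * (A₂ * besselMeasure n lam (D.cube k α)))) := by
            gcongr
            refine le_trans ?_ (mul_le_mul_right (mul_le_mul_right (hA₂ D k α x hx).2 ρ)
              (K.toNNReal : ℝ≥0∞))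
            rw [hρ, ← ENNReal.ofReal, ← ENNReal.ofReal_mul (by positivity),
              ← ENNReal.ofReal_mul hK0]
            refine ENNReal.ofReal_le_ofReal ?_
            refine (ballSize_le_of_dist_le hlam hxH hxH hr0 (s := r / 8) (by positivity)
              (K := 8) (by norm_num) (by linarith) (by simp; linarith)).trans ?_
            gcongr
            exact ballSize_le_mul hlam hxH (by positivity) hlt.le
        _ = _ := by rw [hA]; push_cast; ring
    have h2 := inv_le_mul_inv_of_le_mul (besselMeasure_besselBall_ne_zero hlam hxH hr0)
      (ENNReal.mul_ne_top ENNReal.coe_ne_top ENNReal.ofReal_ne_top) h1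
    calc (besselMeasure n lam (D.cube k α))⁻¹ ^ 2 ≤ (A * ρ * b⁻¹) ^ 2 := by gcongr
      _ = A ^ 2 * b⁻¹ ^ 2 * (ρ * ρ) := by ring
      -- One factor ρ already makes the series over generations converge; the other is bounded by 1.
      _ ≤ A ^ 2 * b⁻¹ ^ 2 * (ρ * 1) := by gcongr
      _ = _ := by rw [mul_one]
  calc D.kernel lam x y
      = ∑' (k : ℤ) (α : D.A k), (D.cube k α).indicator 1 x * (D.cube k α).indicator 1 y *
          (besselMeasure n lam (D.cube k α))⁻¹ ^ 2 := ENNReal.tsum_sigma' _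
    _ ≤ ∑' k : ℤ, A ^ 2 * b⁻¹ ^ 2 *
          {k : ℤ | r / 8 < δ ^ k}.indicator (fun k => ENNReal.ofReal (r / 8 / δ ^ k)) k := by
        refine ENNReal.tsum_le_tsum fun k => ?_
        -- Each generation is a partition, so it contributes at most one cube.
        by_cases h : ∃ α : D.A k, x ∈ D.cube k α ∧ y ∈ D.cube k α
        · obtain ⟨α, hx, hy⟩ := h
          rw [tsum_eq_single α]
          · simpa [indicator_of_mem hx, indicator_of_mem hy] using hcube k α hx hy
          · intro β hβ
            have : x ∉ D.cube k β := fun hxβ => hβ (D.eq_of_mem_cube hxβ hx)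
            simp [indicator_of_notMem this]
        · push Not at h
          rw [ENNReal.tsum_eq_zero.2]
          · exact zero_le
          · intro α
            by_cases hx : x ∈ D.cube k α
            · simp [indicator_of_notMem (h α hx)]
            · simp [indicator_of_notMem hx]
    _ ≤ A ^ 2 * b⁻¹ ^ 2 * (1 - ENNReal.ofReal δ)⁻¹ := by
        rw [ENNReal.tsum_mul_left]
        gcongr
        exact tsum_zpow_ratio_le hδ0 hδ1 (by positivity)
    _ = _ := by
        rw [ENNReal.coe_mul (A ^ 2), ENNReal.coe_toNNReal hSt, ENNReal.coe_pow]; ring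

/-- The Besov kernel is dominated by the dyadic kernels of adjacent systems. -/
lemma exists_le_sum_kernel (n : ℕ) {lam : ℝ} (hlam : 0 < lam) {δ : ℝ} (hδ0 : 0 < δ)
    (hδ1 : δ < 1) :
    ∃ A : ℝ≥0, ∀ (κ : ℕ) (Cadj : ℝ) (D : AdjacentSystems n κ δ Cadj), ∀ x ∈ halfSpace n,
      ∀ y ∈ halfSpace n, x ≠ y →
      (besselMeasure n lam (besselBall x (dist x y)))⁻¹ ^ 2 ≤
        A * ∑ ν, (D.sys ν).kernel lam x y := by
  obtain ⟨A₁, hA₁⟩ := exists_besselMeasure_besselBall_bounds n hlam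
  obtain ⟨A₂, hA₂⟩ := exists_besselMeasure_cube_bounds n hlam hδ0
  -- From δ^{k+3} < 2r one gets δ^k < 2δ⁻³ r. The size of the adjacent cube is read off from its
  -- generation k, so the constant is independent of `Cadj`.
  set L : ℝ := 2 * (δ ^ 3)⁻¹ with hL
  have hL1 : 1 ≤ L := by
    have : 1 ≤ (δ ^ 3)⁻¹ := (one_le_inv₀ (by positivity)).2 (pow_le_one₀ hδ0.le hδ1.le)
    linarith
  set K : ℝ := L ^ (n + 1) * L ^ (2 * lam) with hK
  have hK0 : 0 ≤ K := by positivity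
  set A : ℝ≥0 := A₂ * K.toNNReal * A₁ with hA
  refine ⟨A ^ 2, fun κ Cadj D x hx y hy hxy => ?_⟩
  set r := dist x y with hr
  have hr0 : 0 < r := dist_pos.2 hxy
  -- The radius 2r, with r = |x-y|, puts y inside the open ball about x.
  obtain ⟨k, hk1, hk2⟩ : ∃ k : ℤ, δ ^ (k + 3) < 2 * r ∧ 2 * r ≤ δ ^ (k + 2) := by
    obtain ⟨N, hN1, hN2⟩ := exists_mem_Ioc_zpow (show 0 < 2 * r by positivity)
      (one_lt_inv₀ hδ0 |>.2 hδ1)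
    rw [inv_zpow'] at hN1 hN2
    refine ⟨-N - 3, ?_, ?_⟩
    · rwa [show -N - 3 + 3 = -N by ring]
    · rwa [show -N - 3 + 2 = -(N + 1) by ring]
  obtain ⟨ν, α, -, hsub, -⟩ := D.adjacent x hx (2 * r) k hk1 hk2
  have hxQ : x ∈ (D.sys ν).cube k α := hsub ⟨Metric.mem_ball_self (by positivity), hx⟩
  have hyQ : y ∈ (D.sys ν).cube k α :=
    hsub ⟨by rw [Metric.mem_ball, dist_comm]; linarith, hy⟩
  have hδk : 0 < δ ^ k := zpow_pos hδ0 k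
  have hkr : δ ^ k ≤ L * r := by
    rw [zpow_add₀ hδ0.ne'] at hk1
    have h3 : δ ^ k * δ ^ 3 < 2 * r := by exact_mod_cast hk1
    rw [hL, mul_right_comm, ← div_eq_mul_inv, le_div_iff₀ (by positivity)]
    exact h3.le
  have h1 : besselMeasure n lam ((D.sys ν).cube k α) ≤
      A * besselMeasure n lam (besselBall x r) := by
    calc besselMeasure n lam ((D.sys ν).cube k α)
        ≤ A₂ * ENNReal.ofReal (ballSize lam x (δ ^ k)) := (hA₂ _ k α x hxQ).1
      _ ≤ A₂ * (K.toNNReal * (A₁ * besselMeasure n lam (besselBall x r))) := by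
          gcongr
          refine le_trans ?_ (mul_le_mul_right (hA₁ x hx r hr0).2 (K.toNNReal : ℝ≥0∞))
          rw [← ENNReal.ofReal, ← ENNReal.ofReal_mul hK0]
          refine ENNReal.ofReal_le_ofReal ?_
          exact ballSize_le_of_dist_le hlam hx hx hδk hr0 hL1 hkr (by simpa using hkr)
      _ = _ := by rw [hA]; push_cast; ring
  have h2 := inv_le_mul_inv_of_le_mul ((D.sys ν).besselMeasure_cube_ne_zero hδ0 hlam k α)
    ENNReal.coe_ne_top h1
  calc (besselMeasure n lam (besselBall x r))⁻¹ ^ 2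
      ≤ (A * (besselMeasure n lam ((D.sys ν).cube k α))⁻¹) ^ 2 := by gcongr
    _ = A ^ 2 * (((D.sys ν).cube k α).indicator 1 x * ((D.sys ν).cube k α).indicator 1 y *
          (besselMeasure n lam ((D.sys ν).cube k α))⁻¹ ^ 2) := by
        simp only [indicator_of_mem hxQ, indicator_of_mem hyQ, Pi.one_apply]; ring
    _ ≤ A ^ 2 * (D.sys ν).kernel lam x y := by
        gcongr
        exact ENNReal.le_tsum (f := fun Q : (D.sys ν).Index =>
          ((D.sys ν).cube Q.1 Q.2).indicator 1 x * ((D.sys ν).cube Q.1 Q.2).indicator 1 y *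
          (besselMeasure n lam ((D.sys ν).cube Q.1 Q.2))⁻¹ ^ 2) ⟨k, α⟩
    _ ≤ _ := by
        rw [ENNReal.coe_pow]
        gcongr
        exact Finset.single_le_sum (f := fun ν => (D.sys ν).kernel lam x y)
          (fun _ _ => zero_le) (Finset.mem_univ ν)

/-! ### Lebesgue differentiation and telescoping along dyadic cubes. -/

/-- The Besicovitch differentiation theorem is applied on all of ℝ^{n+1}, so finiteness is also
needed near boundary points; there the weight is bounded because its exponent is positive. -/
lemma isLocallyFiniteMeasure_besselMeasure (n : ℕ) {lam : ℝ} (hlam : 0 < lam) :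
    IsLocallyFiniteMeasure (besselMeasure n lam) := by
  refine ⟨fun x => ⟨Metric.ball x 1, Metric.ball_mem_nhds x one_pos, ?_⟩⟩
  rw [besselMeasure_ball]
  exact (besselMeasure_ball_le hlam x zero_le_one).trans_lt
    (ENNReal.mul_lt_top measure_ball_lt_top ENNReal.ofReal_lt_top)

lemma ae_mem_halfSpace (n : ℕ) (lam : ℝ) : ∀ᵐ x ∂besselMeasure n lam, x ∈ halfSpace n :=
  (withDensity_absolutelyContinuous _ _).ae_le
    (ae_restrict_mem (isOpen_halfSpace n).measurableSet)

/-- Ratios of the measures of dyadic cubes sharing a point. -/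
lemma exists_cube_ratio_bounds (n : ℕ) {lam : ℝ} (hlam : 0 < lam) {δ : ℝ} (hδ0 : 0 < δ)
    (hδ1 : δ < 1) :
    ∃ A : ℝ≥0, ∀ (D : DyadicSystem n δ) (k : ℤ) (α : D.A k), ∀ x ∈ D.cube k α,
      (∀ (j : ℕ) (β : D.A (k + j)), x ∈ D.cube (k + j) β →
        besselMeasure n lam (D.cube (k + j) β) ≤
          A * ENNReal.ofReal δ ^ j * besselMeasure n lam (D.cube k α)) ∧
      (∀ β : D.A (k + 1), x ∈ D.cube (k + 1) β →
        besselMeasure n lam (D.cube k α) ≤ A * besselMeasure n lam (D.cube (k + 1) β)) ∧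
      besselMeasure n lam (Metric.closedBall x (8 * δ ^ k)) ≤
        A * besselMeasure n lam (D.cube k α) := by
  obtain ⟨A₁, hA₁⟩ := exists_besselMeasure_besselBall_bounds n hlam
  obtain ⟨A₂, hA₂⟩ := exists_besselMeasure_cube_bounds n hlam hδ0
  have hδi : 1 ≤ δ⁻¹ := (one_le_inv₀ hδ0).2 hδ1.le
  set K : ℝ := δ⁻¹ ^ (n + 1) * δ⁻¹ ^ (2 * lam) with hK
  set L : ℝ := 16 ^ (n + 1) * 16 ^ (2 * lam) with hL
  have hK0 : 0 ≤ K := by positivity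
  have hL0 : 0 ≤ L := by positivity
  refine ⟨A₂ * A₂ + A₂ * K.toNNReal * A₂ + A₁ * L.toNNReal * A₂, fun D k α x hx => ?_⟩
  have hxH := D.cube_subset_halfSpace k α hx
  have hδk : 0 < δ ^ k := zpow_pos hδ0 k
  refine ⟨fun j β hβ => ?_, fun β hβ => ?_, ?_⟩
  · have hkj : δ ^ (k + j) = δ ^ k * δ ^ j := by rw [zpow_add₀ hδ0.ne', zpow_natCast]
    have hV : ballSize lam x (δ ^ (k + (j : ℤ))) ≤ δ ^ j * ballSize lam x (δ ^ k) := by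
      refine (ballSize_le_mul hlam hxH (by positivity) (r := δ ^ k) ?_).trans_eq ?_
      · rw [hkj]
        exact mul_le_of_le_one_right hδk.le (pow_le_one₀ hδ0.le hδ1.le)
      · rw [hkj, mul_div_cancel_left₀ _ hδk.ne']
    calc besselMeasure n lam (D.cube (k + j) β)
        ≤ A₂ * ENNReal.ofReal (ballSize lam x (δ ^ (k + (j : ℤ)))) := (hA₂ D _ β x hβ).1
      _ ≤ A₂ * (ENNReal.ofReal δ ^ j * (A₂ * besselMeasure n lam (D.cube k α))) := by
          gcongr
          refine le_trans ?_ (mul_le_mul_right (hA₂ D k α x hx).2 _)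
          rw [← ENNReal.ofReal_pow hδ0.le, ← ENNReal.ofReal_mul (by positivity)]
          exact ENNReal.ofReal_le_ofReal hV
      _ = ((A₂ * A₂ : ℝ≥0) : ℝ≥0∞) * ENNReal.ofReal δ ^ j *
            besselMeasure n lam (D.cube k α) := by push_cast; ring
      _ ≤ _ := by
          gcongr
          rw [add_assoc]
          exact le_self_add
  · have hk1 : δ ^ k = δ⁻¹ * δ ^ (k + 1) := by
      rw [zpow_add₀ hδ0.ne', zpow_one]; field_simp
    calc besselMeasure n lam (D.cube k α)
        ≤ A₂ * ENNReal.ofReal (ballSize lam x (δ ^ k)) := (hA₂ D k α x hx).1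
      _ ≤ A₂ * (K.toNNReal * (A₂ * besselMeasure n lam (D.cube (k + 1) β))) := by
          gcongr
          refine le_trans ?_ (mul_le_mul_right (hA₂ D _ β x hβ).2 (K.toNNReal : ℝ≥0∞))
          rw [← ENNReal.ofReal, ← ENNReal.ofReal_mul hK0]
          exact ENNReal.ofReal_le_ofReal (ballSize_le_of_dist_le hlam hxH hxH hδk
            (by positivity) hδi hk1.le (by simpa using hk1.le))
      _ = ((A₂ * K.toNNReal * A₂ : ℝ≥0) : ℝ≥0∞) * besselMeasure n lam (D.cube (k + 1) β) := by
          push_cast; ring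
      _ ≤ _ := by
          gcongr
          rw [add_right_comm]
          exact le_add_self
  · calc besselMeasure n lam (Metric.closedBall x (8 * δ ^ k))
        ≤ besselMeasure n lam (Metric.ball x (16 * δ ^ k)) :=
          measure_mono (Metric.closedBall_subset_ball (by linarith))
      _ ≤ A₁ * ENNReal.ofReal (ballSize lam x (16 * δ ^ k)) := by
          rw [besselMeasure_ball]
          exact (hA₁ x hxH _ (by positivity)).1
      _ ≤ A₁ * (L.toNNReal * (A₂ * besselMeasure n lam (D.cube k α))) := by
          gcongr
          refine le_trans ?_ (mul_le_mul_right (hA₂ D k α x hx).2 (L.toNNReal : ℝ≥0∞))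
          rw [← ENNReal.ofReal, ← ENNReal.ofReal_mul hL0]
          exact ENNReal.ofReal_le_ofReal (ballSize_le_of_dist_le hlam hxH hxH (by positivity)
            hδk (by norm_num) le_rfl (by simp))
      _ = ((A₁ * L.toNNReal * A₂ : ℝ≥0) : ℝ≥0∞) * besselMeasure n lam (D.cube k α) := by
          push_cast; ring
      _ ≤ _ := by
          gcongr
          exact le_add_self

lemma integral_normalizedMeasure_sub {n : ℕ} {lam : ℝ} {E : Set (Space n)}
    (h0 : besselMeasure n lam E ≠ 0) (h1 : besselMeasure n lam E ≠ ∞) {f : Space n → ℂ}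
    (hf : IntegrableOn f E (besselMeasure n lam)) (c : ℂ) :
    ‖∫ z, f z ∂normalizedMeasure lam E - c‖ₑ ≤
      (besselMeasure n lam E)⁻¹ * ∫⁻ z in E, ‖f z - c‖ₑ ∂besselMeasure n lam := by
  have := isProbabilityMeasure_normalizedMeasure h0 h1
  have hfi : Integrable f (normalizedMeasure lam E) :=
    hf.smul_measure (ENNReal.inv_ne_top.2 h0)
  have h : ∫ z, f z ∂normalizedMeasure lam E - c = ∫ z, (f z - c) ∂normalizedMeasure lam E := by
    rw [integral_sub hfi (integrable_const _)]; simp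
  rw [h, ← lintegral_normalizedMeasure]
  exact enorm_integral_le_lintegral_enorm _

/-- Lebesgue differentiation along dyadic cubes. -/
lemma ae_tendsto_integral_cube {n : ℕ} {lam : ℝ} (hlam : 0 < lam) {δ : ℝ} (hδ0 : 0 < δ)
    (hδ1 : δ < 1) (D : DyadicSystem n δ) {f : Space n → ℂ}
    (hf : ∀ k α, IntegrableOn f (D.cube k α) (besselMeasure n lam)) :
    ∀ᵐ x ∂besselMeasure n lam, ∀ Q : ∀ k, D.A k, (∀ k, x ∈ D.cube k (Q k)) → ∀ k : ℤ,
      Filter.Tendsto (fun j : ℕ =>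
        ∫ z, f z ∂normalizedMeasure lam (D.cube (k + j) (Q (k + j)))) Filter.atTop (nhds (f x)) := by
  have := isLocallyFiniteMeasure_besselMeasure n hlam
  obtain ⟨A, hA⟩ := exists_cube_ratio_bounds n hlam hδ0 hδ1
  set m := besselMeasure n lam with hm
  -- f is integrable only cube by cube, so differentiation is applied to its restriction to each
  -- cube; there are countably many, hence one common null set.
  have hloc : ∀ P : D.Index, ∀ᵐ x ∂m, Filter.Tendsto
      (fun a => ⨍ y in a, ‖(D.cube P.1 P.2).indicator f y - (D.cube P.1 P.2).indicator f x‖ ∂m)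
      ((Besicovitch.vitaliFamily m).filterAt x) (nhds 0) := fun P =>
    (Besicovitch.vitaliFamily m).ae_tendsto_average_norm_sub
      ((integrable_indicator_iff (D.measurableSet_cube _ _)).2 (hf P.1 P.2)).locallyIntegrable
  filter_upwards [ae_all_iff.2 hloc] with x hx Q hQ k
  set g := (D.cube k (Q k)).indicator f with hg
  have hgi : Integrable g m :=
    (integrable_indicator_iff (D.measurableSet_cube _ _)).2 (hf k (Q k))
  -- The cube of generation k+j through x lies in the closed ball of radius 8δ^{k+j} about x and has
  -- comparable measure, so convergence over these balls passes to the cubes.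
  have hr : Filter.Tendsto (fun j : ℕ => 8 * δ ^ (k + (j : ℤ))) Filter.atTop
      (nhdsWithin 0 (Ioi 0)) := by
    refine tendsto_nhdsWithin_iff.2 ⟨?_, Filter.Eventually.of_forall fun j => ?_⟩
    · have h := (tendsto_pow_atTop_nhds_zero_of_lt_one hδ0.le hδ1).const_mul (8 * δ ^ k)
      rw [mul_zero] at h
      refine h.congr fun j => ?_
      rw [zpow_add₀ hδ0.ne', zpow_natCast, mul_assoc]
    · have : 0 < δ ^ (k + (j : ℤ)) := zpow_pos hδ0 _
      exact mem_Ioi.2 (by positivity)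
  have hlim := ((hx ⟨k, Q k⟩).comp (Besicovitch.tendsto_filterAt m x)).comp hr
  have hlim' := (ENNReal.tendsto_ofReal hlim)
  rw [ENNReal.ofReal_zero] at hlim'
  have hlimA := ENNReal.Tendsto.const_mul (a := (A : ℝ≥0∞)) hlim' (Or.inr ENNReal.coe_ne_top)
  rw [mul_zero] at hlimA
  rw [tendsto_iff_edist_tendsto_0]
  refine tendsto_of_tendsto_of_tendsto_of_le_of_le tendsto_const_nhds hlimA (fun _ => zero_le)
    fun j => ?_
  set E := D.cube (k + j) (Q (k + j)) with hE
  set B := Metric.closedBall x (8 * δ ^ (k + (j : ℤ))) with hB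
  have hxE : x ∈ E := hQ _
  have hE0 : m E ≠ 0 := D.besselMeasure_cube_ne_zero hδ0 hlam _ _
  have hE1 : m E ≠ ∞ := D.besselMeasure_cube_ne_top hδ0 hlam _ _
  have hEk : E ⊆ D.cube k (Q k) := D.cube_subset_cube (by omega) (hQ k) hxE
  have hEB : E ⊆ B := fun y hy => (D.dist_lt hy hxE).le
  have hB0 : m B ≠ 0 := fun h => hE0 (measure_mono_null hEB h)
  have hBA : m B ≤ A * m E := (hA D _ _ x hxE).2.2
  have hB1 : m B ≠ ∞ := (hBA.trans_lt (ENNReal.mul_lt_top ENNReal.coe_lt_top hE1.lt_top)).ne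
  calc edist (∫ z, f z ∂normalizedMeasure lam E) (f x)
      = ‖∫ z, f z ∂normalizedMeasure lam E - f x‖ₑ := edist_eq_enorm_sub _ _
    _ ≤ (m E)⁻¹ * ∫⁻ z in E, ‖f z - f x‖ₑ ∂m :=
        integral_normalizedMeasure_sub hE0 hE1 (hf _ _) _
    _ = (m E)⁻¹ * ∫⁻ z in E, ‖g z - g x‖ₑ ∂m := by
        congr 1
        refine setLIntegral_congr_fun (D.measurableSet_cube _ _) fun z hz => ?_
        simp only [hg, indicator_of_mem (hEk hz), indicator_of_mem (hEk hxE)]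
    _ ≤ (A * (m B)⁻¹) * ∫⁻ z in B, ‖g z - g x‖ₑ ∂m :=
        mul_le_mul' (inv_le_mul_inv_of_le_mul hB0 ENNReal.coe_ne_top hBA)
          (lintegral_mono_set hEB)
    _ = A * ENNReal.ofReal (⨍ y in B, ‖g y - g x‖ ∂m) := by
        have hBi : IntegrableOn (fun y => g y - g x) B m :=
          hgi.integrableOn.sub (integrableOn_const hB1)
        rw [ofReal_setAverage hBi.norm (ae_of_all _ fun _ => norm_nonneg _), mul_assoc,
          ENNReal.div_eq_inv_mul]
        simp only [ofReal_norm]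

namespace DyadicSystem

variable {n : ℕ} {δ : ℝ}

/-- The function equal to `a α` on the cube `cube k α`. -/
noncomputable def step (D : DyadicSystem n δ) {k : ℤ} (a : D.A k → ℝ≥0∞) (x : Space n) : ℝ≥0∞ :=
  ∑' α, (D.cube k α).indicator (fun _ => a α) x

lemma step_of_mem (D : DyadicSystem n δ) {k : ℤ} (a : D.A k → ℝ≥0∞) {x : Space n} {α : D.A k}
    (hx : x ∈ D.cube k α) : D.step a x = a α := by
  rw [step, tsum_eq_single α, indicator_of_mem hx]
  intro β hβ
  exact indicator_of_notMem (fun h => hβ (D.eq_of_mem_cube h hx)) _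

lemma measurable_step (D : DyadicSystem n δ) {k : ℤ} (a : D.A k → ℝ≥0∞) : Measurable (D.step a) :=
  Measurable.tsum fun α => measurable_const.indicator (D.measurableSet_cube k α)

lemma lintegral_step (D : DyadicSystem n δ) {k : ℤ} (a : D.A k → ℝ≥0∞) (μ : Measure (Space n)) :
    ∫⁻ x, D.step a x ∂μ = ∑' α, a α * μ (D.cube k α) := by
  simp only [step]
  rw [lintegral_tsum fun α =>
    (measurable_const.indicator (D.measurableSet_cube k α)).aemeasurable]
  refine tsum_congr fun α => ?_
  rw [lintegral_indicator (D.measurableSet_cube k α), setLIntegral_const]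

lemma tsum_setLIntegral_cube_le (D : DyadicSystem n δ) (k : ℤ) (F : Space n → ℝ≥0∞)
    (μ : Measure (Space n)) : ∑' α, ∫⁻ x in D.cube k α, F x ∂μ ≤ ∫⁻ x, F x ∂μ := by
  rw [← lintegral_iUnion (D.measurableSet_cube k) fun α β h => D.disjoint_cube k α β h]
  exact setLIntegral_le_lintegral _ _

end DyadicSystem

/-- Telescoping over the cubes shrinking to a generic point. -/
lemma exists_ae_enorm_sub_le_tsum (n : ℕ) {lam : ℝ} (hlam : 0 < lam) {δ : ℝ} (hδ0 : 0 < δ)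
    (hδ1 : δ < 1) :
    ∃ A : ℝ≥0, ∀ (D : DyadicSystem n δ) (f : Space n → ℂ),
      (∀ k α, IntegrableOn f (D.cube k α) (besselMeasure n lam)) →
      ∀ᵐ x ∂besselMeasure n lam, ∀ Q : ∀ k, D.A k, (∀ k, x ∈ D.cube k (Q k)) → ∀ k : ℤ,
        ‖f x - ∫ z, f z ∂normalizedMeasure lam (D.cube k (Q k))‖ₑ ≤
          A * ∑' j : ℕ, meanOsc lam f (D.cube (k + j) (Q (k + j))) := by
  obtain ⟨A, hA⟩ := exists_cube_ratio_bounds n hlam hδ0 hδ1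
  refine ⟨A, fun D f hf => ?_⟩
  filter_upwards [ae_tendsto_integral_cube hlam hδ0 hδ1 D hf] with x hx Q hQ k
  set c : ℤ → ℂ := fun l => ∫ z, f z ∂normalizedMeasure lam (D.cube l (Q l)) with hc
  -- The averages over a cube and over its child differ by at most a multiple of the oscillation on
  -- the larger cube, since the two measures are comparable.
  have hstep : ∀ l, edist (c l) (c (l + 1)) ≤ A * meanOsc lam f (D.cube l (Q l)) := by
    intro l
    have h0 := D.besselMeasure_cube_ne_zero hδ0 hlam (l + 1) (Q (l + 1))
    have h1 := D.besselMeasure_cube_ne_top hδ0 hlam (l + 1) (Q (l + 1))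
    have h0' := D.besselMeasure_cube_ne_zero hδ0 hlam l (Q l)
    rw [edist_comm, edist_eq_enorm_sub, meanOsc_eq, lintegral_normalizedMeasure, ← mul_assoc]
    refine (integral_normalizedMeasure_sub h0 h1 (hf _ _) (c l)).trans (mul_le_mul' ?_ ?_)
    · exact inv_le_mul_inv_of_le_mul h0' ENNReal.coe_ne_top ((hA D l _ x (hQ l)).2.1 _ (hQ _))
    · exact lintegral_mono_set (D.cube_subset_cube (by omega) (hQ _) (hQ _))
  have h := edist_le_tsum_of_edist_le_of_tendsto₀ (f := fun j : ℕ => c (k + j))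
    (fun j => A * meanOsc lam f (D.cube (k + j) (Q (k + j))))
    (fun j => by
      have := hstep (k + j)
      rw [add_assoc] at this
      exact_mod_cast this) (hx Q hQ k)
  rw [ENNReal.tsum_mul_left] at h
  rw [← edist_eq_enorm_sub, edist_comm]
  simpa using h

/-- A John-Nirenberg type inequality: the `p`-oscillations are controlled by the mean
oscillations, in `ℓ^p` over all cubes. -/
lemma exists_tsum_osc_rpow_le (n : ℕ) {lam : ℝ} (hlam : 0 < lam) {δ : ℝ} (hδ0 : 0 < δ)
    (hδ1 : δ < 1) {p : ℝ} (hp : 1 < p) :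
    ∃ C : ℝ≥0, ∀ (D : DyadicSystem n δ) (f : Space n → ℂ), Measurable f →
      (∀ k α, IntegrableOn f (D.cube k α) (besselMeasure n lam)) →
      ∑' Q : D.Index, ∫⁻ x, ‖f x - ∫ z, f z ∂normalizedMeasure lam (D.cube Q.1 Q.2)‖ₑ ^ p
        ∂normalizedMeasure lam (D.cube Q.1 Q.2) ≤
      C * ∑' Q : D.Index, meanOsc lam f (D.cube Q.1 Q.2) ^ p := by
  obtain ⟨A₁, hA₁⟩ := exists_ae_enorm_sub_le_tsum n hlam hδ0 hδ1
  obtain ⟨A₂, hA₂⟩ := exists_cube_ratio_bounds n hlam hδ0 hδ1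
  have hp0 : 0 < p := by linarith
  -- With θ = √δ, half of the measure decay δ^j = θ^{2j} cancels the Hölder weight θ^{-j}; the
  -- remaining θ^j makes the sum over j converge.
  set θ : ℝ≥0∞ := ENNReal.ofReal (Real.sqrt δ) with hθ
  have hθ0 : θ ≠ 0 := (ENNReal.ofReal_pos.2 (Real.sqrt_pos.2 hδ0)).ne'
  have hθt : θ ≠ ∞ := ENNReal.ofReal_ne_top
  have hθ1 : θ < 1 := ENNReal.ofReal_lt_one.2 (by rw [Real.sqrt_lt' one_pos]; simpa using hδ1)
  have hθ2 : ENNReal.ofReal δ = θ ^ 2 := by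
    rw [hθ, ← ENNReal.ofReal_pow (Real.sqrt_nonneg _), Real.sq_sqrt hδ0.le]
  obtain ⟨A₃, hA₃⟩ := tsum_rpow_le_geometric hp hθ0 hθ1
  have hS : (1 - θ)⁻¹ ≠ ∞ := ENNReal.inv_ne_top.2 (tsub_pos_of_lt hθ1).ne'
  refine ⟨A₁ ^ p * A₃ * A₂ * ((1 - θ)⁻¹).toNNReal, fun D f hfm hf => ?_⟩
  set m := besselMeasure n lam with hm
  set K : ℝ≥0∞ := A₁ ^ p * A₃ * A₂ with hK
  -- G k spreads the mass MO_Q(f)^p uniformly over each Q of generation k, so its integral is the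
  -- ℓ^p sum over that generation. It turns the sum over descendants of a cube into a pointwise
  -- bound.
  set G : ∀ k : ℤ, Space n → ℝ≥0∞ := fun k =>
    D.step fun α : D.A k => meanOsc lam f (D.cube k α) ^ p * (m (D.cube k α))⁻¹ with hG
  have hGm : ∀ k, Measurable (G k) := fun k => D.measurable_step _
  have hGint : ∀ k, ∫⁻ x, G k x ∂m = ∑' α, meanOsc lam f (D.cube k α) ^ p := by
    intro k
    rw [hG, D.lintegral_step]
    refine tsum_congr fun α => ?_
    rw [mul_assoc, ENNReal.inv_mul_cancel (D.besselMeasure_cube_ne_zero hδ0 hlam k α)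
      (D.besselMeasure_cube_ne_top hδ0 hlam k α), mul_one]
  have hpt : ∀ᵐ x ∂m, ∀ (k : ℤ) (α : D.A k), x ∈ D.cube k α →
      (m (D.cube k α))⁻¹ * ‖f x - ∫ z, f z ∂normalizedMeasure lam (D.cube k α)‖ₑ ^ p ≤
        K * ∑' j : ℕ, θ ^ j * G (k + j) x := by
    filter_upwards [hA₁ D f hf] with x hx k α hxα
    choose Q hQ using D.exists_mem_cube (D.cube_subset_halfSpace k α hxα)
    obtain rfl : Q k = α := D.eq_of_mem_cube (hQ k) hxα
    set M : ℕ → ℝ≥0∞ := fun j => meanOsc lam f (D.cube (k + j) (Q (k + j))) with hM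
    have hGx : ∀ j : ℕ, G (k + j) x = M j ^ p * (m (D.cube (k + j) (Q (k + j))))⁻¹ := fun j =>
      D.step_of_mem _ (hQ (k + j))
    have hinv : ∀ j : ℕ, (m (D.cube k (Q k)))⁻¹ ≤
        A₂ * (θ ^ 2) ^ j * (m (D.cube (k + j) (Q (k + j))))⁻¹ := fun j => by
      refine inv_le_mul_inv_of_le_mul (D.besselMeasure_cube_ne_zero hδ0 hlam _ _)
        (ENNReal.mul_ne_top ENNReal.coe_ne_top (ENNReal.pow_ne_top (ENNReal.pow_ne_top hθt))) ?_
      rw [← hθ2]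
      exact (hA₂ D k (Q k) x (hQ k)).1 j _ (hQ _)
    calc (m (D.cube k (Q k)))⁻¹ *
          ‖f x - ∫ z, f z ∂normalizedMeasure lam (D.cube k (Q k))‖ₑ ^ p
        ≤ (m (D.cube k (Q k)))⁻¹ * (A₁ * ∑' j, M j) ^ p := by
          gcongr
          exact hx Q hQ k
      _ ≤ (m (D.cube k (Q k)))⁻¹ * (A₁ ^ p * (A₃ * ∑' j, θ⁻¹ ^ j * M j ^ p)) := by
          rw [ENNReal.mul_rpow_of_nonneg _ _ hp0.le]
          gcongr
          exact hA₃ M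
      _ = A₁ ^ p * A₃ * ∑' j, θ⁻¹ ^ j * M j ^ p * (m (D.cube k (Q k)))⁻¹ := by
          rw [ENNReal.tsum_mul_right]; ring
      _ ≤ A₁ ^ p * A₃ * ∑' j : ℕ, A₂ * (θ ^ j * G (k + j) x) := by
          refine mul_le_mul_right (ENNReal.tsum_le_tsum fun j => ?_) _
          calc θ⁻¹ ^ j * M j ^ p * (m (D.cube k (Q k)))⁻¹
              ≤ θ⁻¹ ^ j * M j ^ p *
                  (A₂ * (θ ^ 2) ^ j * (m (D.cube (k + j) (Q (k + j))))⁻¹) := by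
                gcongr; exact hinv j
            _ = A₂ * ((θ⁻¹ * θ) ^ j * θ ^ j *
                  (M j ^ p * (m (D.cube (k + j) (Q (k + j))))⁻¹)) := by ring
            _ = A₂ * (θ ^ j * G (k + j) x) := by
                rw [ENNReal.inv_mul_cancel hθ0 hθt, one_pow, one_mul, hGx]
      _ = K * ∑' j : ℕ, θ ^ j * G (k + j) x := by
          rw [ENNReal.tsum_mul_left, hK]; ring
  have hgen : ∀ k : ℤ, ∑' α : D.A k,
      ∫⁻ x, ‖f x - ∫ z, f z ∂normalizedMeasure lam (D.cube k α)‖ₑ ^ p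
        ∂normalizedMeasure lam (D.cube k α) ≤
      K * ∑' j : ℕ, θ ^ j * ∑' α, meanOsc lam f (D.cube (k + j) α) ^ p := by
    intro k
    calc ∑' α : D.A k, ∫⁻ x, ‖f x - ∫ z, f z ∂normalizedMeasure lam (D.cube k α)‖ₑ ^ p
          ∂normalizedMeasure lam (D.cube k α)
        ≤ ∑' α : D.A k, ∫⁻ x in D.cube k α, K * ∑' j : ℕ, θ ^ j * G (k + j) x ∂m := by
          refine ENNReal.tsum_le_tsum fun α => ?_
          rw [lintegral_normalizedMeasure,
            ← lintegral_const_mul _ (((hfm.sub_const _).enorm).pow_const p)]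
          refine lintegral_mono_ae ?_
          filter_upwards [ae_restrict_of_ae hpt, ae_restrict_mem (D.measurableSet_cube k α)]
            with x hx hxα
          exact hx k α hxα
      _ ≤ ∫⁻ x, K * ∑' j : ℕ, θ ^ j * G (k + j) x ∂m := D.tsum_setLIntegral_cube_le k _ m
      _ = K * ∑' j : ℕ, θ ^ j * ∑' α, meanOsc lam f (D.cube (k + j) α) ^ p := by
          rw [lintegral_const_mul _ (Measurable.tsum fun j => (hGm _).const_mul _),
            lintegral_tsum fun j => ((hGm _).const_mul _).aemeasurable]
          congr 1
          refine tsum_congr fun j => ?_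
          rw [lintegral_const_mul _ (hGm _), hGint]
  rw [ENNReal.tsum_sigma', ENNReal.tsum_sigma']
  calc _ ≤ ∑' k : ℤ, K * ∑' j : ℕ, θ ^ j * ∑' α, meanOsc lam f (D.cube (k + j) α) ^ p :=
        ENNReal.tsum_le_tsum hgen
    -- Since k runs over all of ℤ, the shift by j leaves the total sum unchanged, and only ∑ θ^j
    -- remains.
    _ = K * ∑' j : ℕ, θ ^ j * ∑' (k : ℤ) (α : D.A k), meanOsc lam f (D.cube k α) ^ p := by
        rw [ENNReal.tsum_mul_left, ENNReal.tsum_comm]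
        congr 1
        refine tsum_congr fun j => ?_
        rw [ENNReal.tsum_mul_left]
        congr 1
        exact (Equiv.addRight (j : ℤ)).tsum_eq
          fun k => ∑' α : D.A k, meanOsc lam f (D.cube k α) ^ p
    _ = _ := by
        rw [ENNReal.tsum_mul_right, ENNReal.tsum_geometric, ← mul_assoc, ENNReal.coe_mul,
          ENNReal.coe_toNNReal hS, hK, ENNReal.coe_mul, ENNReal.coe_mul,
          ENNReal.coe_rpow_of_nonneg _ hp0.le]

/-! ### Measurable representatives and integrability on cubes. -/

/-- The half space is a countable union of compact subsets. The result supplies the measurable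
representative on which Tonelli's theorem is used. -/
lemma LpLoc.aestronglyMeasurable {n : ℕ} {lam p : ℝ} {f : Space n → ℂ} (hf : LpLoc lam p f) :
    AEStronglyMeasurable f (besselMeasure n lam) := by
  set K : ℕ → Set (Space n) := fun j =>
    Metric.closedBall 0 j ∩ {x | 1 / ((j : ℝ) + 1) ≤ x (Fin.last n)} with hK
  have hKc : ∀ j, IsCompact (K j) := fun j =>
    (isCompact_closedBall _ _).inter_right (isClosed_le continuous_const (by fun_prop))
  have hKH : ∀ j, K j ⊆ halfSpace n := fun j x hx =>
    lt_of_lt_of_le (by positivity) (show 1 / ((j : ℝ) + 1) ≤ x (Fin.last n) from hx.2)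
  have hU : ⋃ j, K j = halfSpace n := by
    refine (iUnion_subset hKH).antisymm fun x hx => ?_
    have hx' : 0 < x (Fin.last n) := hx
    obtain ⟨i, hi⟩ := exists_nat_ge (dist x 0)
    obtain ⟨j, hj⟩ := exists_nat_one_div_lt hx'
    refine mem_iUnion.2 ⟨max i j, Metric.mem_closedBall.2 (hi.trans ?_), ?_⟩
    · exact_mod_cast le_max_left i j
    · refine le_trans ?_ hj.le
      have : (j : ℝ) ≤ (max i j : ℕ) := by exact_mod_cast le_max_right i j
      gcongr
  have hrestrict : (besselMeasure n lam).restrict (⋃ j, K j) = besselMeasure n lam := by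
    rw [hU]
    exact Measure.restrict_eq_self_of_ae_mem (ae_mem_halfSpace n lam)
  rw [← hrestrict, aestronglyMeasurable_iUnion_iff]
  exact fun j => (hf (K j) (hKc j) (hKH j)).aestronglyMeasurable

lemma meanOsc_congr_ae {n : ℕ} {lam : ℝ} {f g : Space n → ℂ} (h : f =ᵐ[besselMeasure n lam] g)
    (E : Set (Space n)) : meanOsc lam f E = meanOsc lam g E := by
  have hE : f =ᵐ[(besselMeasure n lam).restrict E] g := ae_restrict_of_ae h
  rw [meanOsc, meanOsc, average_congr hE]
  refine laverage_congr ?_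
  filter_upwards [hE] with x hx
  rw [hx]

lemma besovNorm_congr_ae {n : ℕ} {lam p : ℝ} {f g : Space n → ℂ}
    (h : f =ᵐ[besselMeasure n lam] g) : besovNorm lam p f = besovNorm lam p g := by
  rw [besovNorm, besovNorm]
  congr 1
  refine lintegral_congr_ae ?_
  filter_upwards [h] with x hx
  refine lintegral_congr_ae ?_
  filter_upwards [h] with y hy
  rw [hx, hy]

lemma oscNorm_congr_ae {n κ : ℕ} {δ Cadj : ℝ} (D : AdjacentSystems n κ δ Cadj) {lam p : ℝ}
    {q : ℝ≥0∞} {f g : Space n → ℂ} (h : f =ᵐ[besselMeasure n lam] g) :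
    oscNorm D lam p q f = oscNorm D lam p q g := by
  simp only [oscNorm, meanOsc_congr_ae h]

lemma measurable_enorm_sub_rpow {n : ℕ} {f : Space n → ℂ} (hf : Measurable f) (p : ℝ) :
    Measurable (Function.uncurry fun x y => ‖f x - f y‖ₑ ^ p) :=
  (((hf.comp measurable_fst).sub (hf.comp measurable_snd)).enorm).pow_const p

lemma DyadicSystem.measurable_kernel {n : ℕ} {δ : ℝ} (D : DyadicSystem n δ) (lam : ℝ) :
    Measurable (Function.uncurry (D.kernel lam)) := by
  have hI : ∀ Q : D.Index, Measurable ((D.cube Q.1 Q.2).indicator (1 : Space n → ℝ≥0∞)) :=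
    fun Q => measurable_one.indicator (D.measurableSet_cube Q.1 Q.2)
  exact Measurable.tsum fun Q =>
    (((hI Q).comp measurable_fst).mul ((hI Q).comp measurable_snd)).mul_const _

/-- Finite oscillation about any constant c, even the default value 0 of the integral, makes f - c
integrable on E, and constants are integrable since E has finite measure. -/
lemma integrableOn_of_meanOsc_lt_top {n : ℕ} {lam : ℝ} {f : Space n → ℂ} (hf : Measurable f)
    {E : Set (Space n)} (h1 : besselMeasure n lam E ≠ ∞)
    (h : meanOsc lam f E < ∞) : IntegrableOn f E (besselMeasure n lam) := by
  rw [meanOsc_eq, lintegral_normalizedMeasure] at h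
  set c := ∫ z, f z ∂normalizedMeasure lam E
  have hfin : ∫⁻ x in E, ‖f x - c‖ₑ ∂besselMeasure n lam < ∞ :=
    ENNReal.lt_top_of_mul_ne_top_right h.ne (ENNReal.inv_ne_zero.2 h1)
  have hsub : IntegrableOn (fun x => f x - c) E (besselMeasure n lam) :=
    ⟨(hf.sub_const c).aestronglyMeasurable, hfin⟩
  refine (hsub.add (integrableOn_const h1 (C := c))).congr_fun_ae (ae_of_all _ fun x => ?_)
  simp

/-! ### The two energy inequalities and the conclusion. -/

/-- The `p`-th power of the Besov norm. -/
noncomputable def besovEnergy {n : ℕ} (lam p : ℝ) (f : Space n → ℂ) : ℝ≥0∞ :=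
  ∫⁻ x, ∫⁻ y, ‖f x - f y‖ₑ ^ p / besselMeasure n lam (besselBall x (dist x y)) ^ 2
    ∂(besselMeasure n lam) ∂(besselMeasure n lam)

/-- The `p`-th power of the `ℓ^p` norm of the mean oscillations over a dyadic system. -/
noncomputable def oscEnergy {n : ℕ} {δ : ℝ} (D : DyadicSystem n δ) (lam p : ℝ)
    (f : Space n → ℂ) : ℝ≥0∞ :=
  ∑' Q : D.Index, meanOsc lam f (D.cube Q.1 Q.2) ^ p

/-- Jensen's inequality on each cube, then Tonelli, then the upper bound for the dyadic kernel. -/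
lemma exists_oscEnergy_le (n : ℕ) {lam : ℝ} (hlam : 0 < lam) {δ : ℝ} (hδ0 : 0 < δ)
    (hδ1 : δ < 1) {p : ℝ} (hp : 1 < p) :
    ∃ A : ℝ≥0, ∀ (D : DyadicSystem n δ) (f : Space n → ℂ), Measurable f →
      oscEnergy D lam p f ≤ A * besovEnergy lam p f := by
  obtain ⟨A, hA⟩ := exists_kernel_le n hlam hδ0 hδ1
  refine ⟨A, fun D f hf => ?_⟩
  calc oscEnergy D lam p f
      ≤ ∑' Q : D.Index, ∫⁻ x, ∫⁻ y, ‖f x - f y‖ₑ ^ p ∂normalizedMeasure lam (D.cube Q.1 Q.2)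
          ∂normalizedMeasure lam (D.cube Q.1 Q.2) := by
        refine ENNReal.tsum_le_tsum fun Q => ?_
        have := D.isProbabilityMeasure_normalizedMeasure hδ0 hlam Q.1 Q.2
        rw [meanOsc_eq]
        exact lintegral_sub_integral_rpow_le _ hp hf
    _ = ∫⁻ x, ∫⁻ y, ‖f x - f y‖ₑ ^ p * D.kernel lam x y ∂besselMeasure n lam
          ∂besselMeasure n lam :=
        D.tsum_lintegral_normalizedMeasure lam (measurable_enorm_sub_rpow hf p)
    _ ≤ ∫⁻ x, ∫⁻ y, A * (‖f x - f y‖ₑ ^ p /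
          besselMeasure n lam (besselBall x (dist x y)) ^ 2) ∂besselMeasure n lam
          ∂besselMeasure n lam := by
        refine lintegral_mono fun x => lintegral_mono fun y => ?_
        rcases eq_or_ne x y with rfl | hxy
        · simp [ENNReal.zero_rpow_of_pos (show 0 < p by linarith)]
        · rw [div_eq_mul_inv, ENNReal.inv_pow, mul_left_comm]
          gcongr
          exact hA D x y hxy
    _ = A * besovEnergy lam p f := by
        simp only [lintegral_const_mul' _ _ ENNReal.coe_ne_top, besovEnergy]

lemma lintegral_mul_sum_kernel {n κ : ℕ} {δ Cadj : ℝ} (D : AdjacentSystems n κ δ Cadj)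
    (lam : ℝ) (A : ℝ≥0) {F : Space n → Space n → ℝ≥0∞} (hF : Measurable (Function.uncurry F)) :
    ∫⁻ x, ∫⁻ y, A * ∑ ν, F x y * (D.sys ν).kernel lam x y ∂besselMeasure n lam
        ∂besselMeasure n lam =
      A * ∑ ν, ∫⁻ x, ∫⁻ y, F x y * (D.sys ν).kernel lam x y ∂besselMeasure n lam
        ∂besselMeasure n lam := by
  have hm : ∀ ν, Measurable (Function.uncurry fun x y => F x y * (D.sys ν).kernel lam x y) :=
    fun ν => hF.mul ((D.sys ν).measurable_kernel lam)
  have hm1 : ∀ ν x, Measurable fun y => F x y * (D.sys ν).kernel lam x y :=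
    fun ν x => (hm ν).comp measurable_prodMk_left
  have hm2 : ∀ ν, Measurable fun x => ∫⁻ y, F x y * (D.sys ν).kernel lam x y
      ∂besselMeasure n lam := fun ν => (hm ν).lintegral_prod_right'
  simp only [lintegral_const_mul' _ _ (ENNReal.coe_ne_top (r := A))]
  rw [← lintegral_finsetSum _ fun ν _ => hm2 ν]
  congr 1
  refine lintegral_congr fun x => ?_
  rw [← lintegral_finsetSum _ fun ν _ => hm1 ν x]

lemma integrableOn_cube_of_oscEnergy_lt_top {n : ℕ} {lam : ℝ} (hlam : 0 < lam) {δ : ℝ}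
    (hδ0 : 0 < δ) {p : ℝ} (hp : 0 < p) (D : DyadicSystem n δ) {f : Space n → ℂ}
    (hf : Measurable f) (hfin : oscEnergy D lam p f < ∞) (k : ℤ) (α : D.A k) :
    IntegrableOn f (D.cube k α) (besselMeasure n lam) := by
  refine integrableOn_of_meanOsc_lt_top hf (D.besselMeasure_cube_ne_top hδ0 hlam k α) ?_
  have h : meanOsc lam f (D.cube k α) ^ p ≠ ∞ :=
    ENNReal.ne_top_of_tsum_ne_top hfin.ne (⟨k, α⟩ : D.Index)
  exact (ENNReal.rpow_lt_top_iff_of_pos hp).1 h.lt_top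

/-- Finite energy makes f integrable on every cube, so its averages are genuine and the
John-Nirenberg type inequality applies. The double average over Q is at most 2^p times the
p-oscillation about ⟨f⟩_Q. -/
lemma exists_lintegral_kernel_le (n : ℕ) {lam : ℝ} (hlam : 0 < lam) {δ : ℝ} (hδ0 : 0 < δ)
    (hδ1 : δ < 1) {p : ℝ} (hp : 1 < p) :
    ∃ C : ℝ≥0, ∀ (D : DyadicSystem n δ) (f : Space n → ℂ), Measurable f →
      oscEnergy D lam p f < ∞ →
      ∫⁻ x, ∫⁻ y, ‖f x - f y‖ₑ ^ p * D.kernel lam x y ∂besselMeasure n lam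
        ∂besselMeasure n lam ≤ C * oscEnergy D lam p f := by
  obtain ⟨C, hC⟩ := exists_tsum_osc_rpow_le n hlam hδ0 hδ1 hp
  have hp0 : 0 < p := by linarith
  refine ⟨2 ^ p * C, fun D f hf hfin => ?_⟩
  have hint := integrableOn_cube_of_oscEnergy_lt_top hlam hδ0 hp0 D hf hfin
  rw [← D.tsum_lintegral_normalizedMeasure lam (measurable_enorm_sub_rpow hf p),
    ENNReal.coe_mul, ENNReal.coe_rpow_of_nonneg _ hp0.le, ENNReal.coe_ofNat, mul_assoc]
  refine le_trans ?_ (mul_le_mul_right (hC D f hf hint) _)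
  rw [← ENNReal.tsum_mul_left]
  refine ENNReal.tsum_le_tsum fun Q => ?_
  have := D.isProbabilityMeasure_normalizedMeasure hδ0 hlam Q.1 Q.2
  exact lintegral_lintegral_sub_rpow_le _ hp.le hf _

lemma exists_besovEnergy_le (n : ℕ) {lam : ℝ} (hlam : 0 < lam) {δ : ℝ} (hδ0 : 0 < δ)
    (hδ1 : δ < 1) {p : ℝ} (hp : 1 < p) :
    ∃ A : ℝ≥0, ∀ (κ : ℕ) (Cadj : ℝ) (D : AdjacentSystems n κ δ Cadj) (f : Space n → ℂ),
      Measurable f → (∀ ν, oscEnergy (D.sys ν) lam p f < ∞) →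
      besovEnergy lam p f ≤ A * ∑ ν, oscEnergy (D.sys ν) lam p f := by
  obtain ⟨A, hA⟩ := exists_le_sum_kernel n hlam hδ0 hδ1
  obtain ⟨C, hC⟩ := exists_lintegral_kernel_le n hlam hδ0 hδ1 hp
  have hp0 : 0 < p := by linarith
  refine ⟨A * C, fun κ Cadj D f hf hfin => ?_⟩
  calc besovEnergy lam p f
      ≤ ∫⁻ x, ∫⁻ y, A * ∑ ν, ‖f x - f y‖ₑ ^ p * (D.sys ν).kernel lam x y
          ∂besselMeasure n lam ∂besselMeasure n lam := by
        refine lintegral_mono_ae ?_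
        filter_upwards [ae_mem_halfSpace n lam] with x hx
        refine lintegral_mono_ae ?_
        filter_upwards [ae_mem_halfSpace n lam] with y hy
        -- On the diagonal the integrand is 0/0, which equals 0 in `ℝ≥0∞`.
        rcases eq_or_ne x y with rfl | hxy
        · simp [ENNReal.zero_rpow_of_pos hp0]
        · rw [div_eq_mul_inv, ENNReal.inv_pow, ← Finset.mul_sum, mul_left_comm]
          gcongr
          exact hA κ Cadj D x hx y hy hxy
    _ = A * ∑ ν, ∫⁻ x, ∫⁻ y, ‖f x - f y‖ₑ ^ p * (D.sys ν).kernel lam x y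
          ∂besselMeasure n lam ∂besselMeasure n lam :=
        lintegral_mul_sum_kernel D lam A (measurable_enorm_sub_rpow hf p)
    _ ≤ A * ∑ ν, C * oscEnergy (D.sys ν) lam p f := by
        gcongr with ν
        exact hC (D.sys ν) f hf (hfin ν)
    _ = _ := by rw [← Finset.mul_sum, ENNReal.coe_mul, mul_assoc]

lemma oscNorm_self {n κ : ℕ} {δ Cadj : ℝ} (D : AdjacentSystems n κ δ Cadj) (lam : ℝ) {p : ℝ}
    (hp : 0 < p) (f : Space n → ℂ) :
    oscNorm D lam p (ENNReal.ofReal p) f = ∑ ν, oscEnergy (D.sys ν) lam p f ^ (1 / p) :=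
  Finset.sum_congr rfl fun _ _ => lorentzNorm_self _ hp

lemma exists_oscNorm_le_and_besovNorm_le (n : ℕ) {lam : ℝ} (hlam : 0 < lam) {δ : ℝ}
    (hδ0 : 0 < δ) (hδ1 : δ < 1) {p : ℝ} (hp : 1 < p) (κ : ℕ) :
    ∃ C : ℝ≥0, 0 < C ∧ ∀ (Cadj : ℝ) (D : AdjacentSystems n κ δ Cadj) (f : Space n → ℂ),
      AEStronglyMeasurable f (besselMeasure n lam) →
      oscNorm D lam p (ENNReal.ofReal p) f ≤ C * besovNorm lam p f ∧
      besovNorm lam p f ≤ C * oscNorm D lam p (ENNReal.ofReal p) f := by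
  obtain ⟨A, hA⟩ := exists_oscEnergy_le n hlam hδ0 hδ1 hp
  obtain ⟨B, hB⟩ := exists_besovEnergy_le n hlam hδ0 hδ1 hp
  have hp0 : 0 < p := by linarith
  have hp1 : 0 ≤ 1 / p := by positivity
  -- One summand for each inequality; the 1 keeps the constant positive, which is also needed when
  -- the oscillation norm is infinite.
  refine ⟨κ * A ^ (1 / p) + (B * κ) ^ (1 / p) + 1, by positivity, fun Cadj D f₀ hf₀ => ?_⟩
  -- Both norms depend only on the almost-everywhere class of the function.
  set f := hf₀.mk f₀ with hfdef
  have hf : Measurable f := hf₀.stronglyMeasurable_mk.measurable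
  rw [oscNorm_congr_ae D hf₀.ae_eq_mk, besovNorm_congr_ae hf₀.ae_eq_mk, ← hfdef]
  have hbesov : besovNorm lam p f = besovEnergy lam p f ^ (1 / p) := rfl
  constructor
  · calc oscNorm D lam p (ENNReal.ofReal p) f
        = ∑ ν, oscEnergy (D.sys ν) lam p f ^ (1 / p) := oscNorm_self D lam hp0 f
      _ ≤ ∑ _ν : Fin κ, (A * besovEnergy lam p f) ^ (1 / p) := by
          gcongr with ν
          exact hA (D.sys ν) f hf
      _ = ((κ * A ^ (1 / p) : ℝ≥0) : ℝ≥0∞) * besovNorm lam p f := by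
          rw [Finset.sum_const, Finset.card_univ, Fintype.card_fin, nsmul_eq_mul, hbesov,
            ENNReal.mul_rpow_of_nonneg _ _ hp1, ENNReal.coe_mul, ENNReal.coe_natCast,
            ENNReal.coe_rpow_of_nonneg _ hp1, mul_assoc]
      _ ≤ _ := by
          gcongr
          rw [add_assoc]
          exact le_self_add
  · rcases eq_or_ne (oscNorm D lam p (ENNReal.ofReal p) f) ∞ with htop | hfin
    · rw [htop, ENNReal.mul_top (ENNReal.coe_ne_zero.2 (by positivity))]
      exact le_top
    -- Bounding each energy by the p-th power of the whole oscillation norm avoids comparing the ℓ^1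
    -- sum over ν with an ℓ^p sum, at the cost of a factor κ^{1/p}.
    · have hle : ∀ ν, oscEnergy (D.sys ν) lam p f ≤
          oscNorm D lam p (ENNReal.ofReal p) f ^ p := fun ν => by
        rw [← ENNReal.rpow_inv_le_iff hp0, oscNorm_self D lam hp0, ← one_div]
        exact Finset.single_le_sum (f := fun ν => oscEnergy (D.sys ν) lam p f ^ (1 / p))
          (fun _ _ => zero_le) (Finset.mem_univ ν)
      have hlt : ∀ ν, oscEnergy (D.sys ν) lam p f < ∞ := fun ν =>
        (hle ν).trans_lt (ENNReal.rpow_lt_top_of_nonneg hp0.le hfin)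
      calc besovNorm lam p f ≤ (B * ∑ ν, oscEnergy (D.sys ν) lam p f) ^ (1 / p) := by
            rw [hbesov]
            gcongr
            exact hB κ Cadj D f hf hlt
        _ ≤ (B * ∑ _ν : Fin κ, oscNorm D lam p (ENNReal.ofReal p) f ^ p) ^ (1 / p) := by
            gcongr with ν
            exact hle ν
        _ = (((B * κ) ^ (1 / p) : ℝ≥0) : ℝ≥0∞) * oscNorm D lam p (ENNReal.ofReal p) f := by
            rw [Finset.sum_const, Finset.card_univ, Fintype.card_fin, nsmul_eq_mul, ← mul_assoc,
              ENNReal.mul_rpow_of_nonneg _ _ hp1, ← ENNReal.rpow_mul, mul_one_div_cancel hp0.ne',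
              ENNReal.rpow_one, ENNReal.coe_rpow_of_nonneg _ hp1, ENNReal.coe_mul,
              ENNReal.coe_natCast]
        _ ≤ _ := by
            gcongr
            rw [add_right_comm]
            exact le_add_self

end Bessel

theorem proposition6p1 (n : ℕ) (lam : ℝ) (hlam : 0 < lam) (p : ℝ) (hp : (n : ℝ) + 1 < p)
    (δ : ℝ) (hδ0 : 0 < δ) (hδ1 : δ < 1) (κ : ℕ) :
    ∃ C : ℝ≥0, 0 < C ∧
      ∀ (Cadj : ℝ), 1 ≤ Cadj → ∀ (D : Bessel.AdjacentSystems n κ δ Cadj)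
        (f : Bessel.Space n → ℂ), Bessel.LpLoc lam p f →
        (Bessel.MemOSC D lam p (ENNReal.ofReal p) f ↔ Bessel.MemBesov lam p f) ∧
        Bessel.oscNorm D lam p (ENNReal.ofReal p) f ≤ C * Bessel.besovNorm lam p f ∧
        Bessel.besovNorm lam p f ≤ C * Bessel.oscNorm D lam p (ENNReal.ofReal p) f := by
  have hp1 : 1 < p := by
    have : (0 : ℝ) ≤ n := n.cast_nonneg
    linarith
  obtain ⟨C, hC0, hC⟩ :=
    Bessel.exists_oscNorm_le_and_besovNorm_le n hlam hδ0 hδ1 hp1 κ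
  refine ⟨C, hC0, fun Cadj _ D f hf => ?_⟩
  obtain ⟨h1, h2⟩ := hC Cadj D f hf.aestronglyMeasurable
  exact ⟨⟨fun h => ⟨hf, h2.trans_lt (ENNReal.mul_lt_top ENNReal.coe_lt_top h)⟩,
    fun h => h1.trans_lt (ENNReal.mul_lt_top ENNReal.coe_lt_top h.2)⟩, h1, h2⟩
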